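/- Conventions. All algebras are complex and need not have a unit; ideals are two-sided ideals that are linear subspaces (not assumed closed). A Fréchet algebra $A$ is an algebra with a jointly continuous product whose underlying space is complete, Hausdorff and topologized by a sequence of seminorms $(p_k)_{k\in\mathbb N}$. $\mathrm{Prim}(A)$ is the set of kernels of the algebraically irreducible representations of $A$. For an ideal $I$ put $\mathrm{hull}(I)=\{J\in\mathrm{Prim}(A): I\subseteq J\}$, and for $C\subseteq\mathrm{Prim}(A)$ put $\ker(C)=\bigcap_{J\in C}J$ (with $\ker(\emptyset)=A$); $C$ is closed if $C=\mathrm{hull}(\ker(C))$. A hull-minimal ideal of $C$ is a smallest (with respect to inclusion) ideal $j(C)$ among the ideals whose hull is $C$. $A$ is semisimple if $\ker(\mathrm{Prim}(A))=\{0\}$. Let $A$ have a continuous involution. It is quasi-symmetric if there is a continuous $*$-homomorphism $\sigma$ of $A$ into a $C^*$-algebra $\mathfrak C$ with $\mathrm{spec}_A(a)\subseteq\mathrm{spec}_{\mathfrak C}(\sigma(a))$ for all $a\in A$ (spectra being taken after adjoining a unit). Write $e(a)=\sum_{k\ge1}a^k/k!$. An element $b$ is polynomially bounded if $e(i\lambda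 b)$ converges for all $\lambda\in\mathbb R$ and for every $k$ there is $c_k>0$ with $p_k(e(i\lambda b))\le c_k(1+|\lambda|)^{c_k}$ for all $\lambda\in\mathbb R$; $A$ is polynomially bounded if its self-adjoint polynomially bounded elements are dense in the space of its self-adjoint elements. For a real $\varphi\in C_c^\infty(\mathbb R)$ with $\varphi(0)=0$ and a polynomially bounded $a$, put $\varphi\{a\}=\frac1{2\pi}\int_{\mathbb R}\hat\varphi(\lambda)\,e(i\lambda a)\,d\lambda$ (a weak integral), where $\hat\varphi(\lambda)=\int_{\mathbb R}\varphi(x)e^{-i\lambda x}\,dx$. Let $C\subseteq\mathrm{Prim}(A)$ be closed and $J\in\mathrm{Prim}(A)\setminus C$. Say that $(a_J,b_J)$ is a constructed pair for $J$ if $a_J=\varphi\{a_0\}$ and $b_J=\psi\{a_0\}$ for data as follows: $u\in\ker(C)$ with $\|\pi_J(u^*u)\|=1$ for some topologically irreducible $*$-representation $\pi_J$ of $A$ on a Hilbert space with kernel $J$; a continuous seminorm $q$ on $A$ with $\|\sigma(x)\|\le q(x)$ for all $x\in A$; an integer $m\ge2$; a self-adjoint polynomially bounded $a_0\in A$ with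 $q(a_0-u^*u)<1/m$; and real $\varphi,\psi\in C_c^\infty(\mathbb R)$ vanishing at $0$ such that $\varphi=1$ on $[1-\frac1m,1+\frac1m]$, $\psi=0$ in a neighbourhood of $[-\frac2m,\frac2m]$, and $\psi\varphi=\varphi$. Corollary 3.11. Let $A$ be a semisimple, quasi-symmetric (through $\sigma$), polynomially bounded Fréchet algebra and let $C$ be a closed subset of $\mathrm{Prim}(A)$. Then for every $J\in\mathrm{Prim}(A)\setminus C$ a constructed pair exists, and every constructed pair $(a_J,b_J)$ satisfies $$b_J\in\ker(C),\qquad a_J\notin J,\qquad b_Ja_J=a_J.\tag{$*$}$$ Moreover the hull-minimal ideal $j(C)$ exists, and whenever elements $a_J,b_J\in A$ satisfying $(*)$ are chosen for all $J\in\mathrm{Prim}(A)\setminus C$ (in particular, elements of constructed pairs), $j(C)$ is the ideal of $A$ generated by the elements $a_J$, $J\in\mathrm{Prim}(A)\setminus C$. -/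

import Mathlib

open Topology
open scoped ContDiff

universe u v

noncomputable section

namespace QuasiSymmetric

/-! ### Ideals and the primitive ideal space of a (not necessarily unital) complex algebra -/

section Algebraic

variable {A : Type u} [NonUnitalRing A] [Module ℂ A]

/-- A linear subspace of `A` that is a two-sided ideal of the algebra `A`. -/
def IsTwoSidedIdeal (I : Submodule ℂ A) : Prop :=
  ∀ x ∈ I, ∀ a : A, a * x ∈ I ∧ x * a ∈ I

/-- The two-sided ideal of the algebra `A` generated by `S`. -/
def idealSpan (S : Set A) : Submodule ℂ A :=
  sInf {I : Submodule ℂ A | IsTwoSidedIdeal I ∧ S ⊆ I}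

/-- Algebraically irreducible representations: nonzero, and without invariant subspaces other
than the two trivial ones. -/
structure IsAlgIrreducible {V : Type*} [AddCommGroup V] [Module ℂ V]
    (T : A →ₙₐ[ℂ] Module.End ℂ V) : Prop where
  nonzero : ∃ a, T a ≠ 0
  simple : ∀ W : Submodule ℂ V, (∀ a, ∀ w ∈ W, T a w ∈ W) → W = ⊥ ∨ W = ⊤

variable (A) in
/-- `Prim A`: the kernels of the algebraically irreducible representations of `A`.  (The space
of such a representation is `{T a v | a ∈ A}` for every `v ≠ 0`, a quotient of the vector space
`A`, so representation spaces in the universe of `A` yield all primitive ideals.) -/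
def Prim : Set (Submodule ℂ A) :=
  {J | ∃ (V : Type u) (_ : AddCommGroup V) (_ : Module ℂ V) (T : A →ₙₐ[ℂ] Module.End ℂ V),
    IsAlgIrreducible T ∧ ∀ a, a ∈ J ↔ T a = 0}

/-- The hull of an ideal: the primitive ideals that contain it. -/
def hull (I : Submodule ℂ A) : Set (Submodule ℂ A) := {J | J ∈ Prim A ∧ I ≤ J}

/-- The kernel of a set of primitive ideals: their intersection (all of `A` for the empty
set). -/
def kernel (C : Set (Submodule ℂ A)) : Submodule ℂ A := sInf C

/-- `C` is a closed subset of `Prim A` for the hull-kernel topology, in which the closure of `C`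
is `hull (kernel C)`. -/
def IsHullKernelClosed (C : Set (Submodule ℂ A)) : Prop := hull (kernel C) = C

variable (A) in
/-- (Jacobson) semisimplicity: the primitive ideals intersect in zero. -/
def IsSemisimple : Prop := kernel (Prim A) = ⊥

/-- `j` is the hull-minimal ideal of `C`: the smallest two-sided ideal with hull `C`. -/
def IsHullMinimalIdeal (C : Set (Submodule ℂ A)) (j : Submodule ℂ A) : Prop :=
  IsLeast {I : Submodule ℂ A | IsTwoSidedIdeal I ∧ hull I = C} j

/-- The two requirements of hull-kernel regularity on a pair `(a_J, b_J)`, for a closed set `C`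
and `J ∉ C`. -/
def IsRegularPair (C : Set (Submodule ℂ A)) (J : Submodule ℂ A) (a b : A) : Prop :=
  b ∈ kernel C ∧ a ∉ J ∧ b * a = a

end Algebraic

/-! ### Polynomially bounded elements and their functional calculus -/

section Calculus

variable {A : Type u} [NonUnitalRing A] [Module ℂ A] [TopologicalSpace A]

/-- `powSucc a k` is the power `a ^ (k + 1)`, which makes sense without a unit. -/
def powSucc (a : A) : ℕ → A
  | 0 => a
  | k + 1 => powSucc a k * a

/-- The terms `a ^ k / k!`, `k ≥ 1`, of the series `e(a)`; the index is shifted by one. -/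
def expTerm (a : A) (k : ℕ) : A := ((k + 1).factorial : ℂ)⁻¹ • powSucc a k

/-- `e(a) = ∑_{k ≥ 1} a ^ k / k!`, that is, `exp(a) - 1`. -/
def expSubOne (a : A) : A := ∑' k, expTerm a k

/-- `b` is polynomially bounded: the series `e(itb)` converge, and each of the seminorms grows
at most polynomially on them. -/
def IsPolyBddElem (p : ℕ → Seminorm ℂ A) (b : A) : Prop :=
  (∀ t : ℝ, Summable (expTerm ((Complex.I * t) • b))) ∧
  ∀ k, ∃ c : ℝ, 0 < c ∧ ∀ t : ℝ, p k (expSubOne ((Complex.I * t) • b)) ≤ c * (1 + |t|) ^ c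

/-- The involutive algebra `A` is polynomially bounded: the self-adjoint polynomially bounded
elements are dense in the space of self-adjoint elements. -/
def IsPolyBddAlgebra [StarRing A] (p : ℕ → Seminorm ℂ A) : Prop :=
  ∀ h : A, IsSelfAdjoint h → h ∈ closure {b : A | IsSelfAdjoint b ∧ IsPolyBddElem p b}

/-- The Fourier transform `t ↦ ∫ φ(x) e^{-itx} dx`. -/
def fourierHat (φ : ℝ → ℝ) (t : ℝ) : ℂ := ∫ x : ℝ, (φ x : ℂ) * Complex.exp (-(Complex.I * t * x))

/-- `x = φ{a}`, the value `(1/2π) ∫ φ^(t) e(ita) dt` of the functional calculus, where the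
`A`-valued integral is a Gelfand-Pettis (weak) integral. -/
def IsFunCalc (φ : ℝ → ℝ) (a x : A) : Prop :=
  ∀ f : A →L[ℂ] ℂ,
    MeasureTheory.Integrable
      (fun t : ℝ => fourierHat φ t * f (expSubOne ((Complex.I * t) • a))) ∧
    f x = (2 * Real.pi : ℂ)⁻¹ *
      ∫ t : ℝ, fourierHat φ t * f (expSubOne ((Complex.I * t) • a))

/-- `φ ∈ C_c^∞(ℝ)`, real valued, with `φ(0) = 0`. -/
def IsTestFun (φ : ℝ → ℝ) : Prop := ContDiff ℝ ∞ φ ∧ HasCompactSupport φ ∧ φ 0 = 0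

end Calculus

/-! ### Quasi-symmetric algebras and the construction of the elements `a_J`, `b_J` -/

section Construction

variable {A : Type u} [NonUnitalRing A] [Module ℂ A] [IsScalarTower ℂ A A] [SMulCommClass ℂ A A]
  [TopologicalSpace A] [StarRing A]

/-- `σ` makes `A` quasi-symmetric: it is a continuous *-homomorphism into a C*-algebra with
`spec(a) ⊆ spec(σ(a))`.  Neither algebra need have a unit, so spectra are taken after adjoining
one (`quasispectrum`); for algebras with a unit this adds the point `0` to both spectra, and the
requirement is then implied by the one on ordinary spectra. -/
def IsQuasiSymmetricHom {B : Type v} [NonUnitalCStarAlgebra B] (σ : A →⋆ₙₐ[ℂ] B) : Prop :=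
  Continuous σ ∧ ∀ a : A, quasispectrum ℂ a ⊆ quasispectrum ℂ (σ a)

/-- Topologically irreducible *-representations on a Hilbert space. -/
structure IsTopIrreducible {H : Type*} [NormedAddCommGroup H] [InnerProductSpace ℂ H]
    [CompleteSpace H] (π : A →⋆ₙₐ[ℂ] (H →L[ℂ] H)) : Prop where
  nonzero : ∃ a, π a ≠ 0
  simple : ∀ W : Submodule ℂ H, IsClosed (W : Set H) → (∀ a, ∀ w ∈ W, π a w ∈ W) →
    W = ⊥ ∨ W = ⊤

/-- The scaling `‖π_J(x)‖ = 1`, for some topologically irreducible *-representation `π_J` of `A`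
with kernel `J`. -/
def HasUnitNormAt (J : Submodule ℂ A) (x : A) : Prop :=
  ∃ (H : Type u) (_ : NormedAddCommGroup H) (_ : InnerProductSpace ℂ H) (_ : CompleteSpace H)
    (π : A →⋆ₙₐ[ℂ] (H →L[ℂ] H)),
    IsTopIrreducible π ∧ (∀ a, a ∈ J ↔ π a = 0) ∧ ‖π x‖ = 1

/-- `a = φ{a₀}` and `b = ψ{a₀}` arise by the functional-calculus construction of `a_J`, `b_J`
from an element `u` of the kernel of `C` with `‖π_J(u* u)‖ = 1`, a continuous seminorm `q`
dominating `‖σ(·)‖`, an integer `m ≥ 2`, a self-adjoint polynomially bounded element `a₀` with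
`q(a₀ - u* u) < 1/m`, and test functions `φ`, `ψ` such that `φ = 1` on `[1 - 1/m, 1 + 1/m]`,
`ψ = 0` near `[-2/m, 2/m]`, and `ψφ = φ`. -/
def IsConstructedPair {B : Type v} [NonUnitalCStarAlgebra B] (p : ℕ → Seminorm ℂ A)
    (σ : A →⋆ₙₐ[ℂ] B) (C : Set (Submodule ℂ A)) (J : Submodule ℂ A) (a b : A) : Prop :=
  ∃ (u : A) (q : Seminorm ℂ A) (m : ℕ) (a₀ : A) (φ ψ : ℝ → ℝ),
    u ∈ kernel C ∧ HasUnitNormAt J (star u * u) ∧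
    Continuous q ∧ (∀ x, ‖σ x‖ ≤ q x) ∧ 2 ≤ m ∧
    IsSelfAdjoint a₀ ∧ IsPolyBddElem p a₀ ∧ q (a₀ - star u * u) < 1 / (m : ℝ) ∧
    IsTestFun φ ∧ IsTestFun ψ ∧
    (∀ᶠ s in 𝓝ˢ (Set.Icc (-(2 / (m : ℝ))) (2 / (m : ℝ))), ψ s = 0) ∧
    (∀ s ∈ Set.Icc (1 - 1 / (m : ℝ)) (1 + 1 / (m : ℝ)), φ s = 1) ∧
    (∀ s, ψ s * φ s = φ s) ∧
    IsFunCalc φ a₀ a ∧ IsFunCalc ψ a₀ b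

end Construction

end QuasiSymmetric

end

/-! Once the pairs exist, the statement about `j(C)` is pure algebra. The ideal generated by the
`a_J` has hull `C`: `a_J ∉ J` removes every `J` outside `C`, and `a_J = b_J a_J` lies in the kernel
of `C`. If `I` is any ideal with hull `C`, then `b_J` lies in every primitive ideal over `I`, hence
is left quasi-regular modulo `I`: some `y` has `y + b_J - y b_J ∈ I`. Multiplying by `a_J` on the
right leaves `a_J`, so `a_J ∈ I` (`mem_of_mul_eq_of_hull_eq`).

The analysis rests on two consequences of the spectral inclusion for `σ`. Every *-homomorphism `τ`
into a C*-algebra satisfies `‖τ x‖ ≤ ‖σ x‖` (`norm_apply_le_of_quasispectrum_subset`), and every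
primitive ideal is the kernel of a topologically irreducible *-representation
(`exists_isTopIrreducible_of_mem_prim`). The latter comes from a pure state vanishing on the
annihilator of a vector, and the GNS construction. With semisimplicity, `σ` is then injective.

By Fourier inversion, `τ` carries `φ{a}` to the continuous functional calculus `φ(τ a)`
(`IsFunCalc.map_eq_cfc`), so the three properties of a pair can be read off in C*-algebras. Over `C`
the image of `a₀` has norm below `1/m`, where `ψ` vanishes; at `J` its norm is a spectral value near
`1`, where `φ = 1`; and `ψφ = φ` gives `b_J a_J = a_J` after applying the injective `σ`. The
elements `φ{a₀}` exist because the rapid decay of the Fourier transform of `φ` beats polynomial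
growth (`exists_isFunCalc`). -/

namespace QuasiSymmetric

/-! ### Primitive ideals, quasi-regularity and hull-minimal ideals -/

section PrimitiveIdeals

variable {A : Type u} [NonUnitalRing A] [Module ℂ A]

theorem isTwoSidedIdeal_of_mem_prim {J : Submodule ℂ A} (hJ : J ∈ Prim A) :
    IsTwoSidedIdeal J := by
  obtain ⟨V, _, _, T, -, hT⟩ := hJ
  intro x hx a
  simp only [hT] at hx ⊢
  simp [map_mul, hx]

theorem isTwoSidedIdeal_sInf {S : Set (Submodule ℂ A)} (hS : ∀ I ∈ S, IsTwoSidedIdeal I) :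
    IsTwoSidedIdeal (sInf S) := by
  intro x hx a
  simp only [Submodule.mem_sInf] at hx ⊢
  exact ⟨fun I hI => (hS I hI x (hx I hI) a).1, fun I hI => (hS I hI x (hx I hI) a).2⟩

theorem isTwoSidedIdeal_idealSpan (S : Set A) : IsTwoSidedIdeal (idealSpan S) :=
  isTwoSidedIdeal_sInf fun _ hI => hI.1

theorem subset_idealSpan (S : Set A) : S ⊆ idealSpan S := fun x hx => by
  simp only [idealSpan, SetLike.mem_coe, Submodule.mem_sInf]
  exact fun I hI => hI.2 hx

theorem idealSpan_le {S : Set A} {I : Submodule ℂ A} (hI : IsTwoSidedIdeal I) (h : S ⊆ I) :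
    idealSpan S ≤ I := sInf_le ⟨hI, h⟩

theorem subset_prim_of_isHullKernelClosed {C : Set (Submodule ℂ A)}
    (hC : IsHullKernelClosed C) : C ⊆ Prim A := by
  rw [← hC]; exact fun J hJ => hJ.1

/-- A left ideal that is maximal among the left ideals containing `L` but not the right modular
unit `b` of `L`. -/
theorem exists_maximal_left_ideal {L : Submodule ℂ A} (hL : ∀ x ∈ L, ∀ a : A, a * x ∈ L)
    {b : A} (hb : b ∉ L) :
    ∃ M : Submodule ℂ A, L ≤ M ∧ (∀ x ∈ M, ∀ a : A, a * x ∈ M) ∧ b ∉ M ∧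
      ∀ N : Submodule ℂ A, M ≤ N → (∀ x ∈ N, ∀ a : A, a * x ∈ N) → b ∉ N → N = M := by
  obtain ⟨M, hLM, hM⟩ := zorn_le_nonempty₀
    {M : Submodule ℂ A | (∀ x ∈ M, ∀ a : A, a * x ∈ M) ∧ b ∉ M} (by
      intro c hc hchain y hy
      refine ⟨sSup c, ⟨?_, ?_⟩, fun z hz => le_sSup hz⟩
      · intro x hx a
        rw [Submodule.mem_sSup_of_directed ⟨y, hy⟩ hchain.directedOn] at hx ⊢
        obtain ⟨N, hN, hxN⟩ := hx
        exact ⟨N, hN, (hc hN).1 x hxN a⟩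
      · rw [Submodule.mem_sSup_of_directed ⟨y, hy⟩ hchain.directedOn]
        rintro ⟨N, hN, hbN⟩
        exact (hc hN).2 hbN) L ⟨hL, hb⟩
  refine ⟨M, hLM, hM.prop.1, hM.prop.2, fun N hMN hN hbN => ?_⟩
  exact le_antisymm (hM.le_of_ge ⟨hN, hbN⟩ hMN) hMN

variable [IsScalarTower ℂ A A] [SMulCommClass ℂ A A]

/-- The representation of `A` by left multiplication on the quotient by a left ideal. -/
def quotientRep (M : Submodule ℂ A) (hM : ∀ x ∈ M, ∀ a : A, a * x ∈ M) :
    A →ₙₐ[ℂ] Module.End ℂ (A ⧸ M) where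
  toFun a := M.mapQ M (LinearMap.mulLeft ℂ a) fun x hx => hM x hx a
  map_smul' c a := by
    ext x; exact congrArg M.mkQ (smul_mul_assoc c a x)
  map_zero' := by ext x; exact congrArg M.mkQ (zero_mul x)
  map_add' a b := by ext x; exact congrArg M.mkQ (add_mul a b x)
  map_mul' a b := by ext x; exact congrArg M.mkQ (mul_assoc a b x)

theorem quotientRep_mk (M : Submodule ℂ A) (hM : ∀ x ∈ M, ∀ a : A, a * x ∈ M) (a x : A) :
    quotientRep M hM a (M.mkQ x) = M.mkQ (a * x) := rfl

/-- An element of all primitive ideals containing `I` is left quasi-regular modulo `I`. -/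
theorem exists_quasiInverse_mod {I : Submodule ℂ A} (hI : IsTwoSidedIdeal I) {b : A}
    (hb : b ∈ kernel (hull I)) : ∃ y : A, y + b - y * b ∈ I := by
  let R : A →ₗ[ℂ] A := LinearMap.id - LinearMap.mulRight ℂ b
  have hR : ∀ x, R x = x - x * b := fun x => rfl
  -- This is the left ideal `A(1 - b) + I`; if it contains `b`, the quasi-inverse can be read off.
  let L : Submodule ℂ A := LinearMap.range R ⊔ I
  have hL : ∀ x ∈ L, ∀ a : A, a * x ∈ L := by
    intro x hx a
    obtain ⟨_, ⟨y, rfl⟩, z, hz, rfl⟩ := Submodule.mem_sup.1 hx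
    rw [mul_add]
    refine Submodule.add_mem_sup ⟨a * y, ?_⟩ (hI z hz a).1
    simp only [hR, mul_sub, mul_assoc]
  by_cases hbL : b ∈ L
  · obtain ⟨_, ⟨y, rfl⟩, z, hz, hyz⟩ := Submodule.mem_sup.1 hbL
    refine ⟨-y, ?_⟩
    have : -y + b - -y * b = z := by
      rw [eq_sub_of_add_eq' hyz, hR, neg_mul]; abel
    rwa [this]
  exfalso
  obtain ⟨M, hLM, hM, hbM, hmax⟩ := exists_maximal_left_ideal hL hbL
  have hmod : ∀ x, x - x * b ∈ M := fun x => hLM (Submodule.mem_sup_left ⟨x, rfl⟩)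
  -- As `b` is a right unit modulo `M`, a left ideal containing `M` and `b` is all of `A`; so
  -- maximality without `b` makes `A ⧸ M` simple.
  have key : ∀ N : Submodule ℂ A, M ≤ N → (∀ x ∈ N, ∀ a : A, a * x ∈ N) → N = M ∨ N = ⊤ := by
    intro N hMN hN
    by_cases hbN : b ∈ N
    · right
      rw [eq_top_iff]
      intro x _
      have := N.add_mem (hMN (hmod x)) (hN b hbN x)
      simpa using this
    · exact Or.inl (hmax N hMN hN hbN)
  let T := quotientRep M hM
  have hT : ∀ a, T a = 0 ↔ ∀ x, a * x ∈ M := by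
    intro a
    constructor
    · intro h x
      have := congrArg (fun f : Module.End ℂ (A ⧸ M) => f (M.mkQ x)) h
      simp only [T, quotientRep_mk] at this
      simpa using this
    · intro h
      ext x
      simpa [T] using (quotientRep_mk M hM a x).trans (by simpa using h x)
  have hker : LinearMap.ker (T : A →ₗ[ℂ] Module.End ℂ (A ⧸ M)) ∈ hull I := by
    refine ⟨⟨A ⧸ M, inferInstance, inferInstance, T, ⟨?_, ?_⟩, fun a => Iff.rfl⟩, ?_⟩
    · by_contra! h
      have h1 := (hT b).1 (h b) b
      exact hbM (by simpa using M.add_mem (hmod b) h1)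
    · intro W hW
      have hMW : M ≤ W.comap M.mkQ := by
        intro x hx
        have : M.mkQ x = 0 := by simpa using hx
        simp only [Submodule.mem_comap, this, W.zero_mem]
      rcases key (W.comap M.mkQ) hMW fun x hx a => hW a _ hx with h | h
      · left
        rw [eq_bot_iff]
        intro w hw
        obtain ⟨x, rfl⟩ := M.mkQ_surjective w
        have : x ∈ W.comap M.mkQ := hw
        rw [h] at this
        simpa using this
      · right
        rw [eq_top_iff]
        intro w _
        obtain ⟨x, rfl⟩ := M.mkQ_surjective w
        have : x ∈ W.comap M.mkQ := by rw [h]; trivial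
        exact this
    · intro x hx
      exact (hT x).2 fun z => hLM (Submodule.mem_sup_right (hI x hx z).2)
  have hbT : b ∈ LinearMap.ker (T : A →ₗ[ℂ] Module.End ℂ (A ⧸ M)) :=
    (Submodule.mem_sInf.1 hb) _ hker
  -- Since `b` annihilates `A ⧸ M`, both `b * b` and `b - b * b` lie in `M`.
  exact hbM (by simpa using M.add_mem (hmod b) ((hT b).1 hbT b))

/-- If `y + b - y * b ∈ I`, multiply by `a` on the right: `b * a = a` cancels both terms containing
`y` and leaves `a`. -/
theorem mem_of_mul_eq_of_hull_eq {I : Submodule ℂ A} (hI : IsTwoSidedIdeal I) {a b : A}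
    (hb : b ∈ kernel (hull I)) (hab : b * a = a) : a ∈ I := by
  obtain ⟨y, hy⟩ := exists_quasiInverse_mod hI hb
  have h : (y + b - y * b) * a = a := by
    rw [sub_mul, add_mul, mul_assoc, hab]; abel
  exact h ▸ (hI _ hy a).2

theorem isHullMinimalIdeal_idealSpan {C : Set (Submodule ℂ A)} (hC : IsHullKernelClosed C)
    {a b : ↥(Prim A \ C) → A} (hab : ∀ J, IsRegularPair C J.1 (a J) (b J)) :
    IsHullMinimalIdeal C (idealSpan (Set.range a)) := by
  have hker : IsTwoSidedIdeal (kernel C) := isTwoSidedIdeal_sInf fun I hI =>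
    isTwoSidedIdeal_of_mem_prim (subset_prim_of_isHullKernelClosed hC hI)
  refine ⟨⟨isTwoSidedIdeal_idealSpan _, ?_⟩, ?_⟩
  · apply Set.Subset.antisymm
    · intro J hJ
      by_contra hJC
      exact (hab ⟨J, hJ.1, hJC⟩).2.1 (hJ.2 (subset_idealSpan _ ⟨_, rfl⟩))
    · intro J hJ
      rw [← hC] at hJ
      refine ⟨hJ.1, le_trans (idealSpan_le hker ?_) hJ.2⟩
      rintro _ ⟨K, rfl⟩
      rw [SetLike.mem_coe, ← (hab K).2.2]
      exact (hker _ (hab K).1 _).2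
  · rintro I ⟨hI, rfl⟩
    refine idealSpan_le hI ?_
    rintro _ ⟨K, rfl⟩
    exact mem_of_mul_eq_of_hull_eq hI (hab K).1 (hab K).2.2

end PrimitiveIdeals

/-! ### Positive functionals and the GNS construction -/

section States

open scoped ComplexOrder InnerProductSpace

variable {R : Type u} [Ring R] [Algebra ℂ R] [StarRing R] [StarModule ℂ R]
  {D : Type v} [CStarAlgebra D] [PartialOrder D] [StarOrderedRing D]

/-- Linear functionals on `R` that are positive for the order pulled back along a
*-homomorphism `τ` into a C*-algebra. -/
structure PositiveAlong (τ : R →⋆ₐ[ℂ] D) where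
  /-- The underlying linear functional. -/
  toLin : R →ₗ[ℂ] ℂ
  nonneg : ∀ x, 0 ≤ τ x → 0 ≤ toLin x

namespace PositiveAlong

variable {τ : R →⋆ₐ[ℂ] D} (F : PositiveAlong τ)

omit [StarModule ℂ R] in
theorem star_mul_self_nonneg (x : R) : 0 ≤ F.toLin (star x * x) :=
  F.nonneg _ (by rw [map_mul, map_star]; exact _root_.star_mul_self_nonneg _)

omit [StarModule ℂ R] in
theorem le_norm_of_isSelfAdjoint {x : R} (hx : IsSelfAdjoint x) :
    F.toLin x ≤ ‖τ x‖ * F.toLin 1 := by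
  have h : 0 ≤ τ (((‖τ x‖ : ℝ) : ℂ) • 1 - x) := by
    have := (hx.map τ).le_algebraMap_norm_self
    rw [map_sub, map_smul, map_one, sub_nonneg]
    rwa [Algebra.algebraMap_eq_smul_one, ← Complex.coe_smul] at this
  have := F.nonneg _ h
  rwa [map_sub, map_smul, sub_nonneg, smul_eq_mul] at this

omit [StarModule ℂ R] in
theorem one_nonneg : 0 ≤ F.toLin 1 := F.nonneg _ (by rw [map_one]; exact zero_le_one)

-- Comparable complex numbers have equal imaginary parts, so the upper bound by a real number forces
-- the value to be real.
omit [StarModule ℂ R] in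
theorem im_eq_zero_of_isSelfAdjoint {x : R} (hx : IsSelfAdjoint x) : (F.toLin x).im = 0 := by
  have h := F.le_norm_of_isSelfAdjoint hx
  have h1 := F.one_nonneg
  have h2 := (Complex.le_def.1 h).2
  have h3 := (Complex.nonneg_iff.1 h1).2
  simpa [← h3] using h2

theorem apply_star (x : R) : F.toLin (star x) = star (F.toLin x) := by
  have h1 := F.im_eq_zero_of_isSelfAdjoint (IsSelfAdjoint.add_star_self x)
  have h2 := F.im_eq_zero_of_isSelfAdjoint (x := Complex.I • (x - star x)) (by
    rw [IsSelfAdjoint, star_smul, star_sub, star_star, Complex.star_def, Complex.conj_I, neg_smul,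
      ← smul_neg, neg_sub])
  rw [map_add] at h1
  rw [map_smul, map_sub] at h2
  apply Complex.ext
  · have : (F.toLin x).re - (F.toLin (star x)).re = 0 := by simpa using h2
    simp; linarith
  · have : (F.toLin x).im + (F.toLin (star x)).im = 0 := by simpa using h1
    simp; linarith

/-- Real and imaginary parts are each bounded by `‖τ x‖ * ‖F.toLin 1‖`. The crude factor `2` is
harmless: the bound only serves compactness. -/
theorem norm_apply_le (x : R) : ‖F.toLin x‖ ≤ 2 * ‖τ x‖ * ‖F.toLin 1‖ := by
  have key : ∀ y : R, IsSelfAdjoint y → |(F.toLin y).re| ≤ ‖τ y‖ * ‖F.toLin 1‖ := by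
    intro y hy
    have h0 : (F.toLin 1).re ≤ ‖F.toLin 1‖ := Complex.re_le_norm _
    have h1 := (Complex.le_def.1 (F.le_norm_of_isSelfAdjoint hy)).1
    have h2 := (Complex.le_def.1 (F.le_norm_of_isSelfAdjoint hy.neg)).1
    simp only [_root_.map_neg, norm_neg, Complex.neg_re, Complex.re_ofReal_mul] at h1 h2
    have h3 := mul_le_mul_of_nonneg_left h0 (norm_nonneg (τ y))
    rw [abs_le]; constructor <;> linarith
  have hn : ‖τ (star x)‖ = ‖τ x‖ := by rw [map_star, norm_star]
  have h1 := key _ (IsSelfAdjoint.add_star_self x)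
  have h2 := key (Complex.I • (x - star x)) (by
    rw [IsSelfAdjoint, star_smul, star_sub, star_star, Complex.star_def, Complex.conj_I, neg_smul,
      ← smul_neg, neg_sub])
  have e1 : ‖τ (x + star x)‖ ≤ 2 * ‖τ x‖ := by
    rw [map_add]; exact (norm_add_le _ _).trans (by rw [hn]; linarith)
  have e2 : ‖τ (Complex.I • (x - star x))‖ ≤ 2 * ‖τ x‖ := by
    rw [map_smul, norm_smul, map_sub, Complex.norm_I, one_mul]
    exact (norm_sub_le _ _).trans (by rw [hn]; linarith)
  rw [map_add, F.apply_star] at h1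
  rw [map_smul, map_sub, F.apply_star] at h2
  have f1 : |(F.toLin x).re| * 2 ≤ 2 * ‖τ x‖ * ‖F.toLin 1‖ := by
    refine le_trans (le_of_eq ?_) (h1.trans (mul_le_mul_of_nonneg_right e1 (norm_nonneg _)))
    have : (F.toLin x + star (F.toLin x)).re = (F.toLin x).re * 2 := by simp; ring
    rw [this, abs_mul, abs_two]
  have f2 : |(F.toLin x).im| * 2 ≤ 2 * ‖τ x‖ * ‖F.toLin 1‖ := by
    refine le_trans (le_of_eq ?_) (h2.trans (mul_le_mul_of_nonneg_right e2 (norm_nonneg _)))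
    have : (Complex.I • (F.toLin x - star (F.toLin x))).re = -((F.toLin x).im * 2) := by
      simp; ring
    rw [this, abs_neg, abs_mul, abs_two]
  linarith [Complex.norm_le_abs_re_add_abs_im (F.toLin x)]

/-! ### The Gelfand-Naimark-Segal representation -/

set_option linter.unusedVariables false in
/-- A synonym of `R`, with the semi-inner product defined by `F`. -/
@[nolint unusedArguments]
def PreSpace (F : PositiveAlong τ) := R

instance : AddCommGroup F.PreSpace := inferInstanceAs (AddCommGroup R)
instance : Module ℂ F.PreSpace := inferInstanceAs (Module ℂ R)

/-- The identity map from `R` to its synonym. -/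
def toPre : R ≃ₗ[ℂ] F.PreSpace := LinearEquiv.refl ℂ _

/-- The semi-inner product defined by `F`. -/
noncomputable abbrev preCore : PreInnerProductSpace.Core ℂ F.PreSpace where
  inner a b := F.toLin (star (F.toPre.symm a) * F.toPre.symm b)
  conj_inner_symm a b := by
    rw [← Complex.star_def, ← F.apply_star, star_mul, star_star]
  re_inner_nonneg _ := (RCLike.nonneg_iff.mp (F.star_mul_self_nonneg _)).1
  add_left _ _ _ := by rw [map_add, star_add, add_mul, map_add]
  smul_left := by simp

noncomputable instance : SeminormedAddCommGroup F.PreSpace :=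
  InnerProductSpace.Core.toSeminormedAddCommGroup (c := F.preCore)
noncomputable instance : InnerProductSpace ℂ F.PreSpace :=
  InnerProductSpace.ofCore F.preCore

theorem pre_inner (a b : R) : ⟪F.toPre a, F.toPre b⟫_ℂ = F.toLin (star a * b) := rfl

theorem pre_norm_sq (a : R) : ‖F.toPre a‖ ^ 2 = (F.toLin (star a * a)).re := by
  rw [← pre_inner, inner_self_eq_norm_sq_to_K]
  norm_cast

/-- Left multiplication on the semi-inner product space. -/
noncomputable def leftMul (a : R) : F.PreSpace →L[ℂ] F.PreSpace :=
  (F.toPre.toLinearMap ∘ₗ LinearMap.mulLeft ℂ a ∘ₗ F.toPre.symm.toLinearMap).mkContinuous ‖τ a‖ <|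
    fun x => by
      obtain ⟨x, rfl⟩ := F.toPre.surjective x
      rw [← sq_le_sq₀ (by positivity) (by positivity), mul_pow]
      simp only [LinearMap.comp_apply, LinearEquiv.coe_coe, LinearEquiv.symm_apply_apply,
        LinearMap.mulLeft_apply, pre_norm_sq]
      -- Boundedness comes from `a* a ≤ ‖a‖² · 1` in the C*-algebra, conjugated by `τ x`.
      have h : 0 ≤ τ (((‖τ a‖ ^ 2 : ℝ) : ℂ) • (star x * x) - star (a * x) * (a * x)) := by
        have h1 := CStarAlgebra.star_mul_le_algebraMap_norm_sq (a := τ a)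
        have h2 := star_left_conjugate_le_conjugate h1 (τ x)
        rw [map_sub, map_smul, sub_nonneg]
        simp only [map_mul, map_star, star_mul, Complex.coe_smul]
        refine le_trans (le_of_eq (by simp only [mul_assoc])) (h2.trans (le_of_eq ?_))
        rw [Algebra.algebraMap_eq_smul_one]
        simp
      have h3 := (Complex.nonneg_iff.1 (F.nonneg _ h)).1
      rw [map_sub, map_smul, Complex.sub_re, smul_eq_mul, Complex.re_ofReal_mul] at h3
      linarith

theorem leftMul_toPre (a x : R) : F.leftMul a (F.toPre x) = F.toPre (a * x) := rfl

/-- The Hilbert space of the representation. -/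
abbrev Space := UniformSpace.Completion F.PreSpace

/-- The class of an element of `R` in the Hilbert space. -/
noncomputable def cls (x : R) : F.Space := ((F.toPre x : F.PreSpace) : F.Space)

theorem inner_cls (x y : R) : ⟪F.cls x, F.cls y⟫_ℂ = F.toLin (star x * y) := by
  rw [cls, cls, UniformSpace.Completion.inner_coe, pre_inner]

theorem isClosed_induction {P : F.Space → Prop} (hP : IsClosed {v | P v})
    (h : ∀ x, P (F.cls x)) (v : F.Space) : P v :=
  UniformSpace.Completion.induction_on v hP fun x => h (F.toPre.symm x)

theorem clm_ext {S T : F.Space →L[ℂ] F.Space} (h : ∀ x, S (F.cls x) = T (F.cls x)) : S = T := by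
  ext v
  exact F.isClosed_induction (P := fun v => S v = T v) (isClosed_eq S.continuous T.continuous) h v

/-- The representation on the Hilbert space. -/
noncomputable def rep : R →⋆ₙₐ[ℂ] (F.Space →L[ℂ] F.Space) where
  toFun a := (F.leftMul a).completion
  map_smul' c a := by
    refine F.clm_ext fun x => ?_
    simp only [cls, ContinuousLinearMap.completion_apply_coe, leftMul_toPre, smul_mul_assoc,
      _root_.map_smul, UniformSpace.Completion.coe_smul, MonoidHom.id_apply,
      smul_apply]
  map_zero' := by
    refine F.clm_ext fun x => ?_
    simp [cls, ContinuousLinearMap.completion_apply_coe, leftMul_toPre,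
      UniformSpace.Completion.coe_zero]
  map_add' a b := by
    refine F.clm_ext fun x => ?_
    simp only [cls, ContinuousLinearMap.completion_apply_coe, leftMul_toPre, add_mul,
      _root_.map_add, UniformSpace.Completion.coe_add, add_apply]
  map_mul' a b := by
    refine F.clm_ext fun x => ?_
    simp only [cls, ContinuousLinearMap.completion_apply_coe, leftMul_toPre, mul_assoc,
      mul_apply_eq_comp]
  map_star' a := by
    refine (ContinuousLinearMap.eq_adjoint_iff _ _).mpr fun v w => ?_
    refine UniformSpace.Completion.induction_on₂ v w (by apply isClosed_eq <;> fun_prop) ?_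
    intro x y
    obtain ⟨x, rfl⟩ := F.toPre.surjective x
    obtain ⟨y, rfl⟩ := F.toPre.surjective y
    simp only [ContinuousLinearMap.completion_apply_coe, leftMul_toPre,
      UniformSpace.Completion.inner_coe, pre_inner]
    simp [mul_assoc]

theorem rep_cls (a x : R) : F.rep a (F.cls x) = F.cls (a * x) := by
  change (F.leftMul a).completion _ = _
  simp only [cls, ContinuousLinearMap.completion_apply_coe, leftMul_toPre]

theorem rep_one : F.rep 1 = 1 := by
  exact F.clm_ext fun x => by simp [rep_cls]

theorem inner_rep (a : R) (v w : F.Space) : ⟪F.rep a v, w⟫_ℂ = ⟪v, F.rep (star a) w⟫_ℂ := by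
  rw [map_star, ContinuousLinearMap.star_eq_adjoint,
    ContinuousLinearMap.adjoint_inner_right]

theorem inner_rep_self_nonneg {a : R} (ha : 0 ≤ τ a) (v : F.Space) : 0 ≤ ⟪v, F.rep a v⟫_ℂ := by
  refine F.isClosed_induction (P := fun v => 0 ≤ ⟪v, F.rep a v⟫_ℂ) ?_ (fun x => ?_) v
  · exact isClosed_le continuous_const (by fun_prop)
  · rw [rep_cls, inner_cls]
    apply F.nonneg
    rw [map_mul, map_mul, ← mul_assoc, map_star]
    exact star_left_conjugate_nonneg ha _

theorem eq_zero_of_inner_cls {v : F.Space} (h : ∀ x, ⟪v, F.cls x⟫_ℂ = 0) : v = 0 := by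
  have := F.isClosed_induction (P := fun w => ⟪v, w⟫_ℂ = 0)
    (isClosed_eq (by fun_prop) continuous_const) h v
  simpa using this

/-- The positive functional `⟨v, π(·) v⟩`, divided by `‖v‖²`. -/
noncomputable def vectorFunctional (v : F.Space) : PositiveAlong τ where
  toLin :=
    { toFun x := (((‖v‖ ^ 2)⁻¹ : ℝ) : ℂ) * ⟪v, F.rep x v⟫_ℂ
      map_add' x y := by simp [mul_add, inner_add_right]
      map_smul' c x := by simp [inner_smul_right]; ring }
  nonneg x hx := by
    refine mul_nonneg ?_ (F.inner_rep_self_nonneg hx v)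
    exact_mod_cast inv_nonneg.2 (sq_nonneg ‖v‖)

theorem vectorFunctional_apply (v : F.Space) (x : R) :
    (F.vectorFunctional v).toLin x = (((‖v‖ ^ 2)⁻¹ : ℝ) : ℂ) * ⟪v, F.rep x v⟫_ℂ := rfl

end PositiveAlong

end States

/-! ### Existence of states and irreducibility for pure states -/

section PureStates

open scoped ComplexOrder InnerProductSpace

variable {R : Type u} [Ring R] [Algebra ℂ R] [StarRing R] [StarModule ℂ R]
  {D : Type v} [CStarAlgebra D] [PartialOrder D] [StarOrderedRing D]

/-- The states on `R`, positive along `τ`, that vanish on `M`. -/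
def stateSet (τ : R →⋆ₐ[ℂ] D) (M : Submodule ℂ R) : Set (R → ℂ) :=
  {f | ∃ F : PositiveAlong τ, ⇑F.toLin = f ∧ F.toLin 1 = 1 ∧ ∀ m ∈ M, F.toLin m = 0}

/-- By Tychonoff: the states lie in a product of discs, and the defining conditions are closed for
pointwise convergence. -/
theorem isCompact_stateSet (τ : R →⋆ₐ[ℂ] D) (M : Submodule ℂ R) : IsCompact (stateSet τ M) := by
  have hsub : stateSet τ M ⊆ Set.pi Set.univ fun x => Metric.closedBall (0 : ℂ) (2 * ‖τ x‖) := by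
    rintro _ ⟨F, rfl, h1, -⟩ x -
    have := F.norm_apply_le x
    rw [h1, norm_one, mul_one] at this
    simpa using this
  refine (isCompact_univ_pi fun x => isCompact_closedBall (0 : ℂ) (2 * ‖τ x‖)).of_isClosed_subset
    ?_ hsub
  have heq : stateSet τ M = {f | ∀ x y, f (x + y) = f x + f y} ∩
      {f | ∀ (c : ℂ) x, f (c • x) = c • f x} ∩ {f | ∀ x, 0 ≤ τ x → 0 ≤ f x} ∩
      {f | f 1 = 1} ∩ {f | ∀ m ∈ M, f m = 0} := by
    ext f
    constructor
    · rintro ⟨F, rfl, h1, hM⟩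
      exact ⟨⟨⟨⟨map_add F.toLin, map_smul F.toLin⟩, F.nonneg⟩, h1⟩, hM⟩
    · rintro ⟨⟨⟨⟨hadd, hsmul⟩, hnn⟩, h1⟩, hM⟩
      exact ⟨⟨⟨⟨f, hadd⟩, hsmul⟩, hnn⟩, rfl, h1, hM⟩
  rw [heq]
  simp only [Set.ofPred_forall]
  refine (((IsClosed.inter ?_ ?_).inter ?_).inter ?_).inter ?_
  · exact isClosed_iInter fun x => isClosed_iInter fun y =>
      isClosed_eq (continuous_apply _) ((continuous_apply x).add (continuous_apply y))
  · exact isClosed_iInter fun c => isClosed_iInter fun y =>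
      isClosed_eq (continuous_apply _) ((continuous_apply _).const_smul c)
  · exact isClosed_iInter fun x => isClosed_iInter fun _ =>
      isClosed_le continuous_const (continuous_apply _)
  · exact isClosed_eq (continuous_apply _) continuous_const
  · exact isClosed_iInter fun x => isClosed_iInter fun _ =>
      isClosed_eq (continuous_apply _) continuous_const

/-- If the invertibility of `x` can be tested on `τ x`, then every proper left ideal is
annihilated by a state. -/
theorem stateSet_nonempty {τ : R →⋆ₐ[ℂ] D} (hτ : ∀ x, IsUnit (τ x) → IsUnit x)
    {M : Submodule ℂ R} (hM : ∀ x ∈ M, ∀ a : R, a * x ∈ M) (h1 : (1 : R) ∉ M) :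
    (stateSet τ M).Nonempty := by
  have hcoe : ∀ (t : ℝ) (x : R), τ (t • x) = t • τ x := fun t x => by
    rw [← Complex.coe_smul, map_smul, Complex.coe_smul]
  have hstar : ∀ (t : ℝ) (x : R), star (t • x) = t • star x := fun t x => by
    rw [star_smul, star_trivial]
  -- The cone consists of the elements whose real part is positive up to a self-adjoint element of
  -- `M`. It contains skew elements and self-adjoint elements of `M` with both signs, so a
  -- functional nonnegative on it vanishes on them.
  let P : PointedCone ℝ R :=
    { carrier := {x | ∃ s ∈ M, IsSelfAdjoint s ∧ 0 ≤ τ (x + star x + s)}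
      add_mem' := by
        rintro x y ⟨s, hs, hs', hx⟩ ⟨t, ht, ht', hy⟩
        refine ⟨s + t, M.add_mem hs ht, hs'.add ht', ?_⟩
        have := add_nonneg hx hy
        rw [← map_add] at this
        rw [star_add]
        convert this using 2
        abel
      zero_mem' := ⟨0, M.zero_mem, IsSelfAdjoint.zero _, by simp⟩
      smul_mem' := by
        rintro ⟨c, hc⟩ x ⟨s, hs, hs', hx⟩
        refine ⟨c • s, ?_, ?_, ?_⟩
        · rw [← Complex.coe_smul]; exact M.smul_mem _ hs
        · rw [IsSelfAdjoint, hstar, hs'.star_eq]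
        · have := smul_nonneg hc hx
          rw [← hcoe, smul_add, smul_add] at this
          change 0 ≤ τ (c • x + star (c • x) + c • s)
          rwa [hstar] }
  have hP : ∀ x, x ∈ P ↔ ∃ s ∈ M, IsSelfAdjoint s ∧ 0 ≤ τ (x + star x + s) := fun x => Iff.rfl
  have hone : (1 : R) ≠ 0 := fun h => h1 (h ▸ M.zero_mem)
  have hD : Nontrivial D := by
    refine ⟨1, 0, fun h => h1 ?_⟩
    have : IsUnit (τ 0) := by
      rw [map_zero, ← h]; exact isUnit_one
    obtain ⟨u, hu⟩ := hτ 0 this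
    have h2 := u.inv_mul
    rw [hu, mul_zero] at h2
    rw [← h2]; exact M.zero_mem
  let f : R →ₗ.[ℝ] ℝ := LinearPMap.mkSpanSingleton (1 : R) (1 : ℝ) hone
  -- A negative multiple of `1` in the cone would give `s ∈ M` with `τ s` bounded below by a
  -- positive scalar; then `s` is invertible and `1 ∈ M`.
  obtain ⟨g, hgf, hgP⟩ := riesz_extension P f (by
    rintro ⟨x, hx⟩ hxP
    obtain ⟨t, rfl⟩ := Submodule.mem_span_singleton.1 hx
    obtain ⟨s, hs, hs', hpos⟩ := (hP _).1 hxP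
    have hf : f ⟨t • 1, hx⟩ = t := by
      simp only [f]
      rw [LinearPMap.mkSpanSingleton'_apply]
      simp
    rw [hf]
    by_contra! ht
    apply h1
    have hle : algebraMap ℝ D (-(2 * t)) ≤ τ s := by
      rw [map_add, map_add, hstar, star_one, hcoe, map_one] at hpos
      rw [Algebra.algebraMap_eq_smul_one, ← sub_nonneg]
      convert hpos using 1
      module
    have hu : IsUnit (τ s) := CStarAlgebra.isUnit_of_le _ hle (by
      rw [IsStrictlyPositive.iff_of_unital]
      exact ⟨algebraMap_nonneg D (by linarith), (IsUnit.mk0 _ (by linarith)).map _⟩)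
    obtain ⟨u, hu⟩ := hτ s hu
    have := hM s hs ↑u⁻¹
    rwa [← hu, u.inv_mul] at this) (by
    intro y
    refine ⟨⟨‖τ (y + star y)‖ • 1, Submodule.smul_mem _ _ (Submodule.mem_span_singleton_self _)⟩,
      (hP _).2 ⟨0, M.zero_mem, IsSelfAdjoint.zero _, ?_⟩⟩
    have h := ((IsSelfAdjoint.add_star_self y).map τ).neg_algebraMap_norm_le_self
    rw [Algebra.algebraMap_eq_smul_one] at h
    have h2 : 0 ≤ ‖τ (y + star y)‖ • (1 : D) := smul_nonneg (norm_nonneg _) zero_le_one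
    have h3 := add_nonneg (neg_le_iff_add_nonneg.1 h) h2
    rw [add_zero, star_add, hstar, star_one]
    convert h3 using 1
    simp only [map_add, hcoe, map_one]
    abel)
  have hgskew : ∀ x, x + star x = 0 → g x = 0 := by
    intro x hx
    have hx1 := hgP x ((hP x).2 ⟨0, M.zero_mem, IsSelfAdjoint.zero _, by simp [hx]⟩)
    have hx2 := hgP (-x) ((hP (-x)).2 ⟨0, M.zero_mem, IsSelfAdjoint.zero _, by
      rw [star_neg, ← neg_add, hx]; simp⟩)
    rw [map_neg] at hx2
    linarith
  have hgM : ∀ s ∈ M, IsSelfAdjoint s → g s = 0 := by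
    have key : ∀ s ∈ M, IsSelfAdjoint s → 0 ≤ g s := by
      intro s hs hs'
      refine hgP s ((hP s).2 ⟨-(2 : ℝ) • s, ?_, ?_, ?_⟩)
      · rw [← Complex.coe_smul]; exact M.smul_mem _ hs
      · rw [IsSelfAdjoint, hstar, hs'.star_eq]
      · rw [hs'.star_eq]
        have : s + s + -(2 : ℝ) • s = 0 := by module
        rw [this, map_zero]
    intro s hs hs'
    have hx1 := key s hs hs'
    have hx2 := key (-s) (M.neg_mem hs) hs'.neg
    rw [map_neg] at hx2
    linarith
  let F : PositiveAlong τ :=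
    { toLin := Module.Dual.extendRCLike g
      nonneg := fun x hx => by
        have hsa : star (τ x) = τ x := (IsSelfAdjoint.of_nonneg hx).star_eq
        have hgx : 0 ≤ g x := hgP x ((hP x).2 ⟨0, M.zero_mem, IsSelfAdjoint.zero _, by
          rw [add_zero, map_add, map_star, hsa]; exact add_nonneg hx hx⟩)
        -- Only `τ x`, not `x`, is known to be self-adjoint, so `hgskew` does not apply; but every
        -- real multiple of `i x` lies in the cone.
        have hIx : ∀ c : ℝ, 0 ≤ c * g (Complex.I • x) := by
          intro c
          rw [← smul_eq_mul, ← map_smul]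
          refine hgP _ ((hP _).2 ⟨0, M.zero_mem, IsSelfAdjoint.zero _, ?_⟩)
          rw [add_zero, map_add, map_star, hcoe, map_smul, star_smul, star_smul, hsa]
          simp
        have hI0 : g (Complex.I • x) = 0 := by
          have h1 := hIx 1
          have h2 := hIx (-1)
          linarith
        rw [Module.Dual.extendRCLike_apply]
        have : g ((RCLike.I : ℂ) • x) = 0 := hI0
        rw [this]
        simpa using hgx }
  have hF : ∀ x, F.toLin x = g x - Complex.I * g (Complex.I • x) := fun x =>
    Module.Dual.extendRCLike_apply g x
  have hg1 : g 1 = 1 := by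
    have := hgf ⟨1, Submodule.mem_span_singleton_self _⟩
    rw [this]
    exact LinearPMap.mkSpanSingleton_apply ℝ ℝ hone (1 : ℝ)
  have hsa0 : ∀ x, IsSelfAdjoint x → g (Complex.I • x) = 0 := fun x hx => hgskew _ (by
    rw [star_smul, hx.star_eq]; simp)
  have hF1 : F.toLin 1 = 1 := by rw [hF, hsa0 1 (IsSelfAdjoint.one _), hg1]; simp
  refine ⟨F.toLin, F, rfl, hF1, fun m hm => ?_⟩
  -- A general `m ∈ M` need not be self-adjoint, but `m* m` is and lies in `M`; so `m` is null in
  -- the GNS space and the functional kills it.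
  have h0 : F.toLin (star m * m) = 0 := by
    have hs : IsSelfAdjoint (star m * m) := IsSelfAdjoint.star_mul_self m
    rw [hF, hsa0 _ hs, hgM _ (hM m hm _) hs]; simp
  have hn : F.cls m = 0 := by
    rw [← inner_self_eq_zero (𝕜 := ℂ), F.inner_cls, h0]
  have := F.inner_cls 1 m
  rw [hn, inner_zero_right, star_one, one_mul] at this
  exact this.symm

/-- An invariant `W` splits the cyclic vector as `ξ = w + w'` and the state as a convex combination
of the vector states of `w` and `w'`, with weights `‖w‖²` and `‖w'‖²`. If both are nonzero,
extremality equates the state of `w` with the original one, whence `w = ‖w‖² ξ`, which is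
incompatible with `w' ≠ 0`. -/
theorem irreducible_of_mem_extremePoints {τ : R →⋆ₐ[ℂ] D} {M : Submodule ℂ R}
    (hM : ∀ x ∈ M, ∀ a : R, a * x ∈ M) {F : PositiveAlong τ}
    (hF : ⇑F.toLin ∈ (stateSet τ M).extremePoints ℝ) {W : Submodule ℂ F.Space}
    (hWc : IsClosed (W : Set F.Space)) (hW : ∀ a, ∀ w ∈ W, F.rep a w ∈ W) : W = ⊥ ∨ W = ⊤ := by
  obtain ⟨F', hF', hF1, hFM⟩ := hF.1
  rw [DFunLike.coe_injective hF'] at hF1 hFM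
  have : CompleteSpace W := hWc.completeSpace_coe
  have hWo : ∀ a, ∀ w ∈ Wᗮ, F.rep a w ∈ Wᗮ := by
    intro a w hw v hv
    rw [← star_star a, ← F.inner_rep]; exact hw _ (hW _ v hv)
  obtain ⟨ξ, hξ⟩ : ∃ ξ, ξ = F.cls 1 := ⟨_, rfl⟩
  have hrep : ∀ x, F.rep x ξ = F.cls x := fun x => by rw [hξ, F.rep_cls, mul_one]
  have hdense : ∀ U : Submodule ℂ F.Space, IsClosed (U : Set F.Space) →
      (∀ a, ∀ w ∈ U, F.rep a w ∈ U) → ξ ∈ U → U = ⊤ := by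
    intro U hUc hU hξU
    rw [eq_top_iff]
    intro v _
    exact F.isClosed_induction (P := fun v => v ∈ U) hUc (fun x => hrep x ▸ hU x _ hξU) v
  obtain ⟨w, hw, w', hw', hsum⟩ := W.exists_add_mem_mem_orthogonal ξ
  by_cases hw0 : w = 0
  · left
    have h := hdense Wᗮ W.isClosed_orthogonal hWo (by rw [hsum, hw0, zero_add]; exact hw')
    rwa [Submodule.orthogonal_eq_top_iff] at h
  by_cases hw'0 : w' = 0
  · right
    exact hdense W hWc hW (by rw [hsum, hw'0, add_zero]; exact hw)
  exfalso
  have hinner : ⟪w, w'⟫_ℂ = 0 := hw' w hw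
  have hξn : ‖ξ‖ ^ 2 = 1 := by
    rw [← inner_self_eq_norm_sq (𝕜 := ℂ), hξ, F.inner_cls, star_one, one_mul, hF1]
    exact RCLike.one_re
  have hnorm : ‖w‖ ^ 2 + ‖w'‖ ^ 2 = 1 := by
    rw [← hξn, hsum, norm_add_sq (𝕜 := ℂ), hinner]; simp
  have hFx : ∀ x, F.toLin x = ⟪w, F.rep x w⟫_ℂ + ⟪w', F.rep x w'⟫_ℂ := by
    intro x
    have h1 := F.inner_cls 1 x
    rw [star_one, one_mul, ← hrep x, ← hξ] at h1
    rw [← h1, hsum, map_add, inner_add_left, inner_add_right, inner_add_right,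
      hWo x w' hw' w hw, (Submodule.mem_orthogonal' W w').1 hw' _ (hW x w hw)]
    ring
  have hmem : ∀ v : F.Space, v ≠ 0 → (∀ m ∈ M, F.rep m v = 0) →
      ⇑(F.vectorFunctional v).toLin ∈ stateSet τ M := by
    intro v hv hvM
    refine ⟨F.vectorFunctional v, rfl, ?_, fun m hm => ?_⟩
    · rw [F.vectorFunctional_apply, F.rep_one, one_apply_eq_self, inner_self_eq_norm_sq_to_K]
      have : (‖v‖ : ℂ) ≠ 0 := by simpa using hv
      push_cast
      exact inv_mul_cancel₀ (pow_ne_zero 2 this)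
    · rw [F.vectorFunctional_apply, hvM m hm, inner_zero_right, mul_zero]
  have hMξ : ∀ m ∈ M, F.rep m w + F.rep m w' = 0 := by
    intro m hm
    rw [← map_add, ← hsum, hrep, ← inner_self_eq_zero (𝕜 := ℂ), F.inner_cls]
    exact hFM _ (hM m hm _)
  -- The two components of `F.rep m ξ = 0` lie in `W` and `Wᗮ`, so both vanish; hence both vector
  -- states vanish on `M`.
  have hMw : ∀ m ∈ M, F.rep m w = 0 := by
    intro m hm
    have h1 : F.rep m w = -F.rep m w' := eq_neg_of_add_eq_zero_left (hMξ m hm)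
    have h2 : F.rep m w ∈ Wᗮ := h1 ▸ Wᗮ.neg_mem (hWo m w' hw')
    have := h2 _ (hW m w hw)
    simpa using this
  have hMw' : ∀ m ∈ M, F.rep m w' = 0 := by
    intro m hm
    have := hMξ m hm
    rwa [hMw m hm, zero_add] at this
  have hwpos : 0 < ‖w‖ ^ 2 := by positivity
  have hw'pos : 0 < ‖w'‖ ^ 2 := by positivity
  have hext := hF.2 (hmem w hw0 hMw) (hmem w' hw'0 hMw')
    ⟨‖w‖ ^ 2, ‖w'‖ ^ 2, hwpos, hw'pos, hnorm, by
      ext x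
      have e1 : (‖w‖ : ℂ) ≠ 0 := by simpa using hw0
      have e2 : (‖w'‖ : ℂ) ≠ 0 := by simpa using hw'0
      simp only [Pi.add_apply, Pi.smul_apply, F.vectorFunctional_apply, Complex.real_smul]
      rw [hFx]
      push_cast
      field_simp⟩
  have hwx : ∀ x, ⟪w, F.rep x w⟫_ℂ = ((‖w‖ ^ 2 : ℝ) : ℂ) * F.toLin x := by
    intro x
    have h := congrFun hext x
    rw [F.vectorFunctional_apply] at h
    rw [← h, ← mul_assoc, ← Complex.ofReal_mul, mul_inv_cancel₀ hwpos.ne', Complex.ofReal_one,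
      one_mul]
  have hw_eq : w - ((‖w‖ ^ 2 : ℝ) : ℂ) • ξ = 0 := by
    apply F.eq_zero_of_inner_cls
    intro x
    rw [inner_sub_left, inner_smul_left, Complex.conj_ofReal, hξ, F.inner_cls, star_one, one_mul,
      ← hwx, ← hrep x]
    rw [hsum, map_add, inner_add_right, hWo x w' hw' w hw]
    ring
  have hw2 : (1 - ((‖w‖ ^ 2 : ℝ) : ℂ)) • w = ((‖w‖ ^ 2 : ℝ) : ℂ) • w' := by
    rw [sub_smul, one_smul, sub_eq_iff_eq_add, ← smul_add, add_comm w', ← hsum]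
    exact sub_eq_zero.1 hw_eq
  have hz : ((‖w‖ ^ 2 : ℝ) : ℂ) * ⟪w', w'⟫_ℂ = 0 := by
    rw [← inner_smul_right, ← hw2, inner_smul_right, inner_eq_zero_symm.1 hinner, mul_zero]
  rcases mul_eq_zero.1 hz with h | h
  · exact hwpos.ne' (by exact_mod_cast h)
  · exact hw'0 (inner_self_eq_zero.1 h)

end PureStates

/-! ### Primitive ideals as kernels of *-representations -/

section Representations

variable {A : Type u} [NonUnitalRing A] [Module ℂ A] [IsScalarTower ℂ A A] [SMulCommClass ℂ A A]
  [StarRing A] [StarModule ℂ A] {B : Type v} [NonUnitalCStarAlgebra B]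

-- Noninvertibility of `c + a` means that `-c` is in the quasispectrum of `a`, which the hypothesis
-- transfers to `σ a`.
omit [StarModule ℂ A] in
theorem isUnit_of_isUnit_starMap {σ : A →⋆ₙₐ[ℂ] B}
    (hσ : ∀ a, quasispectrum ℂ a ⊆ quasispectrum ℂ (σ a)) (x : Unitization ℂ A)
    (hx : IsUnit (Unitization.starMap σ x)) : IsUnit x := by
  by_contra h
  induction x using Unitization.ind with
  | inl_add_inr c a =>
    have e1 : algebraMap ℂ (Unitization ℂ A) (-c) - (a : Unitization ℂ A) =
        -(Unitization.inl c + (a : Unitization ℂ A)) := by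
      rw [Unitization.algebraMap_eq_inl, Unitization.inl_neg]; abel
    have h1 : -c ∈ quasispectrum ℂ a := by
      rw [Unitization.quasispectrum_eq_spectrum_inr ℂ, spectrum.mem_iff, e1, IsUnit.neg_iff]
      exact h
    have h2 := hσ a h1
    rw [Unitization.quasispectrum_eq_spectrum_inr ℂ, spectrum.mem_iff] at h2
    apply h2
    have e2 : algebraMap ℂ (Unitization ℂ B) (-c) - (σ a : Unitization ℂ B) =
        -(Unitization.starMap σ (Unitization.inl c + (a : Unitization ℂ A))) := by
      rw [map_add, Unitization.starMap_inl, Unitization.starMap_inr,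
        Unitization.algebraMap_eq_inl, Unitization.inl_neg]; abel
    rw [e2, IsUnit.neg_iff]
    exact hx

/-- In an algebra whose spectra are controlled by a *-homomorphism into a C*-algebra, every
primitive ideal is the kernel of a topologically irreducible *-representation. -/
theorem exists_isTopIrreducible_of_mem_prim {σ : A →⋆ₙₐ[ℂ] B}
    (hσ : ∀ a, quasispectrum ℂ a ⊆ quasispectrum ℂ (σ a)) {J : Submodule ℂ A} (hJ : J ∈ Prim A) :
    ∃ (H : Type u) (_ : NormedAddCommGroup H) (_ : InnerProductSpace ℂ H) (_ : CompleteSpace H)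
      (π : A →⋆ₙₐ[ℂ] (H →L[ℂ] H)), IsTopIrreducible π ∧ ∀ a, a ∈ J ↔ π a = 0 := by
  obtain ⟨V, _, _, T, hT, hJT⟩ := hJ
  let S : Unitization ℂ A →ₐ[ℂ] Module.End ℂ V := Unitization.lift T
  have hS : ∀ a : A, S (a : Unitization ℂ A) = T a := fun a => by simp [S]
  obtain ⟨a₀, ha₀⟩ := hT.nonzero
  obtain ⟨v, hv⟩ : ∃ v, T a₀ v ≠ 0 := by
    by_contra! h
    exact ha₀ (LinearMap.ext h)
  have hcyc : ∀ w : V, w ≠ 0 → ∀ z : V, ∃ x, S x w = z := by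
    intro w hw z
    let U : Submodule ℂ V := LinearMap.range ((LinearMap.applyₗ w).comp S.toLinearMap)
    have hU : ∀ y, y ∈ U ↔ ∃ x, S x w = y := fun y => Iff.rfl
    have hwU : w ∈ U := (hU w).2 ⟨1, by simp⟩
    rcases hT.simple U (by
      intro a y hy
      obtain ⟨x, rfl⟩ := (hU y).1 hy
      exact (hU _).2 ⟨a * x, by rw [map_mul, hS]; rfl⟩) with h | h
    · rw [h, Submodule.mem_bot] at hwU
      exact absurd hwU hw
    · exact (hU z).1 (h ▸ Submodule.mem_top)
  have hv0 : v ≠ 0 := fun h => hv (by rw [h, map_zero])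
  -- The annihilator of `v` is a maximal left ideal, by irreducibility of `T`.
  let M : Submodule ℂ (Unitization ℂ A) :=
    LinearMap.ker ((LinearMap.applyₗ v).comp S.toLinearMap)
  have hM : ∀ x, x ∈ M ↔ S x v = 0 := fun x => Iff.rfl
  have hMleft : ∀ x ∈ M, ∀ a, a * x ∈ M := by
    intro x hx a
    rw [hM] at hx ⊢
    rw [map_mul, Module.End.mul_apply, hx, map_zero]
  have h1M : (1 : Unitization ℂ A) ∉ M := by
    rw [hM, map_one]; exact hv0
  let _ := CStarAlgebra.spectralOrder (Unitization ℂ B)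
  let _ := CStarAlgebra.spectralOrderedRing (Unitization ℂ B)
  obtain ⟨f, hf⟩ := (isCompact_stateSet (Unitization.starMap σ) M).extremePoints_nonempty
    (stateSet_nonempty (isUnit_of_isUnit_starMap hσ) hMleft h1M)
  obtain ⟨F, rfl, hF1, hFM⟩ := hf.1
  -- The null space of the state is a proper left ideal containing the maximal `M`, so the two
  -- coincide.
  have hmem : ∀ x, x ∈ M ↔ F.cls x = 0 := by
    intro x
    constructor
    · intro hx
      rw [← inner_self_eq_zero (𝕜 := ℂ), F.inner_cls]
      exact hFM _ (hMleft x hx _)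
    · intro hx
      by_contra hxM
      obtain ⟨y, hy⟩ := hcyc _ (fun h => hxM ((hM x).2 h)) v
      have hyx : 1 - y * x ∈ M := by
        rw [hM, map_sub, map_one, map_mul, LinearMap.sub_apply, Module.End.mul_apply, hy]
        simp
      have h0 := hFM _ hyx
      have h2 : F.cls (y * x) = 0 := by rw [← F.rep_cls, hx, map_zero]
      have h3 := F.inner_cls 1 (y * x)
      rw [h2, inner_zero_right, star_one, one_mul] at h3
      rw [map_sub, hF1, ← h3, sub_zero] at h0
      exact one_ne_zero h0
  let π : A →⋆ₙₐ[ℂ] (F.Space →L[ℂ] F.Space) :=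
    F.rep.comp (Unitization.inrNonUnitalStarAlgHom ℂ A)
  have hπ : ∀ a : A, π a = F.rep (a : Unitization ℂ A) := fun a => rfl
  -- Both sides say that `a * x ∈ M` for all `x`: the vectors `S x v` exhaust `V`, and the `F.cls x`
  -- are dense in the Hilbert space.
  have hker : ∀ a, a ∈ J ↔ π a = 0 := by
    intro a
    rw [hJT, hπ]
    constructor
    · intro ha
      refine F.clm_ext fun x => ?_
      rw [F.rep_cls, (hmem _).1 ?_, zero_apply]
      rw [hM, map_mul, hS, ha, zero_mul, LinearMap.zero_apply]
    · intro ha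
      ext z
      obtain ⟨x, rfl⟩ := hcyc v hv0 z
      have : F.cls ((a : Unitization ℂ A) * x) = 0 := by
        rw [← F.rep_cls, ha, zero_apply]
      rw [← hmem, hM, map_mul, hS] at this
      exact this
  refine ⟨F.Space, inferInstance, inferInstance, inferInstance, π, ⟨⟨a₀, ?_⟩, ?_⟩, hker⟩
  · intro h
    exact ha₀ ((hJT _).1 ((hker _).2 h))
  · intro W hWc hW
    refine irreducible_of_mem_extremePoints hMleft hf hWc fun x w hw => ?_
    induction x using Unitization.ind with
    | inl_add_inr c a =>
      have : Unitization.inl c = (c • 1 : Unitization ℂ A) := by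
        rw [← Unitization.algebraMap_eq_inl, Algebra.algebraMap_eq_smul_one]
      rw [this, map_add, map_smul, F.rep_one]
      exact W.add_mem (W.smul_mem c hw) (hW a w hw)

end Representations

/-! ### Fourier transforms of test functions -/

section FourierTransforms

open scoped FourierTransform SchwartzMap

/-- A complex Schwartz function with the same values as a smooth compactly supported real
function. -/
theorem exists_schwartzMap_eq {φ : ℝ → ℝ} (h1 : ContDiff ℝ ∞ φ) (h2 : HasCompactSupport φ) :
    ∃ f : 𝓢(ℝ, ℂ), ∀ x, f x = φ x := by
  have hs : HasCompactSupport (fun x => (φ x : ℂ)) :=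
    h2.comp_left (g := Complex.ofReal) Complex.ofReal_zero
  have hd : ContDiff ℝ ∞ (fun x => (φ x : ℂ)) := Complex.ofRealCLM.contDiff.comp h1
  exact ⟨hs.toSchwartzMap hd, fun x => rfl⟩

/-- The notation `𝓕` uses the kernel `e^{-2πixξ}`, whence the rescaling by `2π`. -/
theorem fourierHat_eq {φ : ℝ → ℝ} {f : 𝓢(ℝ, ℂ)} (hf : ∀ x, f x = φ x) (t : ℝ) :
    fourierHat φ t = (𝓕 f : 𝓢(ℝ, ℂ)) (t / (2 * Real.pi)) := by
  rw [SchwartzMap.fourier_coe, Real.fourier_real_eq_integral_exp_smul, fourierHat]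
  congr 1
  ext x
  rw [hf, smul_eq_mul, mul_comm]
  congr 2
  have : (Real.pi : ℂ) ≠ 0 := by exact_mod_cast Real.pi_ne_zero
  push_cast
  field_simp

theorem continuous_fourierHat {φ : ℝ → ℝ} (h1 : ContDiff ℝ ∞ φ) (h2 : HasCompactSupport φ) :
    Continuous (fourierHat φ) := by
  obtain ⟨f, hf⟩ := exists_schwartzMap_eq h1 h2
  rw [funext (fourierHat_eq hf)]
  exact (𝓕 f : 𝓢(ℝ, ℂ)).continuous.comp (continuous_id.div_const _)

theorem integrable_fourierHat {φ : ℝ → ℝ} (h1 : ContDiff ℝ ∞ φ) (h2 : HasCompactSupport φ) :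
    MeasureTheory.Integrable (fourierHat φ) := by
  obtain ⟨f, hf⟩ := exists_schwartzMap_eq h1 h2
  rw [funext (fourierHat_eq hf)]
  exact (𝓕 f : 𝓢(ℝ, ℂ)).integrable.comp_div (by positivity)

theorem exists_fourierHat_decay {φ : ℝ → ℝ} (h1 : ContDiff ℝ ∞ φ) (h2 : HasCompactSupport φ)
    (n : ℕ) : ∃ K, 0 ≤ K ∧ ∀ t, (1 + |t|) ^ n * ‖fourierHat φ t‖ ≤ K := by
  obtain ⟨f, hf⟩ := exists_schwartzMap_eq h1 h2
  set g : 𝓢(ℝ, ℂ) := 𝓕 f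
  obtain ⟨K, hK⟩ : ∃ K, ∀ t, (1 + ‖t‖) ^ n * ‖g t‖ ≤ K := ⟨_, fun t => by
    have := SchwartzMap.one_add_le_sup_seminorm_apply (𝕜 := ℝ) (m := (n, 0)) le_rfl le_rfl g t
    rwa [norm_iteratedFDeriv_zero] at this⟩
  have hpi : (1 : ℝ) ≤ 2 * Real.pi := by linarith [Real.pi_gt_three]
  have hK0 : 0 ≤ K := le_trans (by positivity) (hK 0)
  refine ⟨(2 * Real.pi) ^ n * K, by positivity, fun t => ?_⟩
  rw [fourierHat_eq hf]
  refine le_trans ?_ (mul_le_mul_of_nonneg_left (hK (t / (2 * Real.pi))) (by positivity))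
  rw [← mul_assoc, ← mul_pow]
  gcongr
  rw [Real.norm_eq_abs, abs_div, abs_of_pos (by positivity : (0 : ℝ) < 2 * Real.pi)]
  rw [mul_add, mul_div_cancel₀ _ (by positivity)]
  linarith

theorem integral_fourierHat_mul_exp {φ : ℝ → ℝ} (h1 : ContDiff ℝ ∞ φ) (h2 : HasCompactSupport φ)
    (x : ℝ) : ∫ t : ℝ, fourierHat φ t * Complex.exp (Complex.I * t * x) = 2 * Real.pi * φ x := by
  obtain ⟨f, hf⟩ := exists_schwartzMap_eq h1 h2
  have hinv : (𝓕⁻ (𝓕 f : 𝓢(ℝ, ℂ)) : 𝓢(ℝ, ℂ)) x = φ x := by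
    rw [FourierTransform.fourierInv_fourier_eq, hf]
  rw [SchwartzMap.fourierInv_coe, Real.fourierInv_eq'] at hinv
  have hcv := MeasureTheory.Measure.integral_comp_div
    (fun w : ℝ => (𝓕 f : 𝓢(ℝ, ℂ)) w * Complex.exp (Complex.I * (2 * Real.pi * w : ℝ) * x))
    (2 * Real.pi)
  have e1 : ∀ t : ℝ, fourierHat φ t * Complex.exp (Complex.I * t * x) =
      (𝓕 f : 𝓢(ℝ, ℂ)) (t / (2 * Real.pi)) *
        Complex.exp (Complex.I * (2 * Real.pi * (t / (2 * Real.pi)) : ℝ) * x) := by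
    intro t
    rw [fourierHat_eq hf, mul_div_cancel₀ _ (by positivity)]
  simp_rw [e1]
  rw [hcv, abs_of_pos (by positivity), ← hinv]
  rw [Complex.real_smul]
  push_cast
  congr 1
  congr 1
  ext w
  rw [smul_eq_mul, mul_comm]
  congr 2
  simp
  ring

end FourierTransforms

/-! ### Domination of *-homomorphisms by `σ` -/

section SpectralComparison

variable {A : Type u} [NonUnitalRing A] [Module ℂ A]
  [StarRing A] {B : Type v} [NonUnitalCStarAlgebra B] {E : Type*} [CStarAlgebra E]

/-- A *-homomorphism into a C*-algebra is dominated by a *-homomorphism `σ` into a C*-algebra that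
controls the spectra. -/
theorem norm_apply_le_of_quasispectrum_subset {σ : A →⋆ₙₐ[ℂ] B}
    (hσ : ∀ a, quasispectrum ℂ a ⊆ quasispectrum ℂ (σ a)) (τ : A →⋆ₙₐ[ℂ] E) (x : A) :
    ‖τ x‖ ≤ ‖σ x‖ := by
  -- For self-adjoint elements the norm is the spectral radius, and `σ` has the larger spectrum; the
  -- C*-identity then reduces `x` to `x* x`.
  have key : ∀ y : A, IsSelfAdjoint y → ‖τ y‖ ≤ ‖σ y‖ := by
    intro y hy
    have h1 := (hy.map τ).spectralRadius_eq_nnnorm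
    have h2 := (IsSelfAdjoint.inr ℂ (hy.map σ)).spectralRadius_eq_nnnorm
    have h3 : spectrum ℂ (τ y) ⊆ spectrum ℂ (σ y : Unitization ℂ B) := by
      rw [← Unitization.quasispectrum_eq_spectrum_inr ℂ]
      exact (spectrum_subset_quasispectrum ℂ _).trans
        ((NonUnitalAlgHom.quasispectrum_apply_subset τ y).trans (hσ y))
    have h4 : spectralRadius ℂ (τ y) ≤ spectralRadius ℂ (σ y : Unitization ℂ B) :=
      biSup_mono fun k hk => h3 hk
    rw [h1, h2] at h4
    have h5 : ‖τ y‖ ≤ ‖(σ y : Unitization ℂ B)‖ := by exact_mod_cast h4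
    rwa [Unitization.norm_inr] at h5
  have h := key _ (IsSelfAdjoint.star_mul_self x)
  rw [map_mul, map_mul, map_star, map_star, CStarRing.norm_star_mul_self,
    CStarRing.norm_star_mul_self] at h
  exact abs_le_of_sq_le_sq' (by nlinarith) (norm_nonneg _) |>.2

end SpectralComparison

/-! ### Comparison of `φ{a}` with the continuous functional calculus -/

section FunctionalCalculus

variable {A : Type u} [NonUnitalRing A] [Module ℂ A]
  [TopologicalSpace A] [StarRing A] {E : Type v} [CStarAlgebra E]

theorem hasSum_expTerm (h : E) : HasSum (expTerm h) (NormedSpace.exp h - 1) := by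
  have hpow : ∀ k, powSucc h k = h ^ (k + 1) := by
    intro k
    induction k with
    | zero => simp [powSucc]
    | succ k ih => rw [powSucc, ih, ← pow_succ]
  have h1 := NormedSpace.exp_series_hasSum_exp' (𝕂 := ℂ) h
  have h2 := (hasSum_nat_add_iff' 1).2 h1
  simp only [Finset.sum_range_one, pow_zero, Nat.factorial_zero, Nat.cast_one, inv_one,
    one_smul] at h2
  have h3 : expTerm h = fun k => ((k + 1).factorial : ℂ)⁻¹ • h ^ (k + 1) :=
    funext fun k => by simp only [expTerm, hpow]
  rwa [h3]

theorem map_expSubOne [T2Space A] {τ : A →⋆ₙₐ[ℂ] E} (hτ : Continuous τ) {b : A}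
    (hb : Summable (expTerm b)) : τ (expSubOne b) = NormedSpace.exp (τ b) - 1 := by
  have hpow : ∀ k, τ (powSucc b k) = powSucc (τ b) k := by
    intro k
    induction k with
    | zero => rfl
    | succ k ih => rw [powSucc, map_mul, ih, powSucc]
  have h1 := hb.hasSum.map τ hτ
  have h2 : ⇑τ ∘ expTerm b = expTerm (τ b) := by
    ext k
    simp only [Function.comp_apply, expTerm, map_smul, hpow]
  rw [h2] at h1
  exact h1.unique (hasSum_expTerm _)

theorem exp_smul_eq_cfc (h : E) (hh : IsSelfAdjoint h) (c : ℂ) :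
    NormedSpace.exp (c • h) - 1 = cfc (fun z : ℂ => Complex.exp (c * z) - 1) h := by
  have hn : IsStarNormal h := hh.isStarNormal
  rw [cfc_sub .., cfc_const_one .., cfc_comp' Complex.exp (fun z : ℂ => c * z) h, cfc_const_mul_id ..,
    CFC.complex_exp_eq_normedSpace_exp]

/-- The functional calculus `φ{a}` is compatible with the continuous functional calculus. -/
theorem IsFunCalc.map_eq_cfc [T2Space A] {φ : ℝ → ℝ} (hφ : IsTestFun φ) {a x : A}
    (hx : IsFunCalc φ a x) (ha : IsSelfAdjoint a)
    (hsum : ∀ t : ℝ, Summable (expTerm ((Complex.I * t) • a)))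
    {τ : A →⋆ₙₐ[ℂ] E} (hτ : Continuous τ) : τ x = cfc φ (τ a) := by
  obtain ⟨hd, hc, h0⟩ := hφ
  have hh : IsSelfAdjoint (τ a) := ha.map τ
  have hn : IsStarNormal (τ a) := hh.isStarNormal
  have hcont : Continuous (Function.uncurry fun (t : ℝ) (z : ℂ) =>
      fourierHat φ t * (Complex.exp (Complex.I * t * z) - 1)) := by
    have := continuous_fourierHat hd hc
    simp only [Function.uncurry_def]
    fun_prop
  have hreal : ∀ z ∈ spectrum ℂ (τ a), z = z.re := fun z hz => hh.mem_spectrum_eq_re hz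
  have hbound : ∀ t : ℝ, ∀ z ∈ spectrum ℂ (τ a),
      ‖fourierHat φ t * (Complex.exp (Complex.I * t * z) - 1)‖ ≤ 2 * ‖fourierHat φ t‖ := by
    intro t z hz
    rw [norm_mul, mul_comm]
    refine mul_le_mul_of_nonneg_right ?_ (norm_nonneg _)
    refine (norm_sub_le _ _).trans ?_
    rw [hreal z hz, norm_one, mul_assoc, ← Complex.ofReal_mul, mul_comm Complex.I,
      Complex.norm_exp_ofReal_mul_I]
    norm_num
  have hint : MeasureTheory.HasFiniteIntegral (fun t : ℝ => 2 * ‖fourierHat φ t‖) :=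
    ((integrable_fourierHat hd hc).norm.const_mul 2).hasFiniteIntegral
  have hcfc := cfc_integral (μ := MeasureTheory.volume) _ _ (τ a) hcont.continuousOn
    (Filter.Eventually.of_forall hbound) hint
  have hintE := integrable_cfc (μ := MeasureTheory.volume) _ _ (τ a) hcont.continuousOn
    (Filter.Eventually.of_forall hbound) hint
  have hval : ∀ t : ℝ, cfc (fun z : ℂ => fourierHat φ t * (Complex.exp (Complex.I * t * z) - 1))
      (τ a) = fourierHat φ t • τ (expSubOne ((Complex.I * t) • a)) := by
    intro t
    rw [map_expSubOne hτ (hsum t), map_smul, exp_smul_eq_cfc _ hh, ← cfc_smul ..]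
    rfl
  -- The term `-1` in `exp - 1` contributes `-∫ fourierHat φ = -2π φ(0)`, which is zero because
  -- `φ(0) = 0`.
  have hφval : ∀ z ∈ spectrum ℂ (τ a), ∫ t : ℝ, fourierHat φ t *
      (Complex.exp (Complex.I * t * z) - 1) = 2 * Real.pi * (φ z.re : ℂ) := by
    intro z hz
    have i1 : MeasureTheory.Integrable fun t : ℝ =>
        fourierHat φ t * Complex.exp (Complex.I * t * z.re) := by
      refine (integrable_fourierHat hd hc).mono ?_ (Filter.Eventually.of_forall fun t => ?_)
      · have := continuous_fourierHat hd hc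
        exact Continuous.aestronglyMeasurable (by fun_prop)
      · rw [norm_mul, mul_assoc, ← Complex.ofReal_mul, mul_comm Complex.I,
          Complex.norm_exp_ofReal_mul_I, mul_one]
    have i0 := integral_fourierHat_mul_exp hd hc 0
    simp only [Complex.ofReal_zero, mul_zero, Complex.exp_zero, mul_one, h0] at i0
    rw [hreal z hz]
    simp only [mul_sub, mul_one]
    rw [MeasureTheory.integral_sub i1 (integrable_fourierHat hd hc), i0,
      integral_fourierHat_mul_exp hd hc]
    simp
  rw [cfc_real_eq_complex φ hh]
  have hpi : (2 * Real.pi : ℂ) ≠ 0 := by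
    exact_mod_cast (mul_pos two_pos Real.pi_pos).ne'
  have hφcont : Continuous φ := hd.continuous
  have hcfc2 : (2 * Real.pi : ℂ) • cfc (fun z : ℂ => (φ z.re : ℂ)) (τ a) =
      ∫ t : ℝ, fourierHat φ t • τ (expSubOne ((Complex.I * t) • a)) := by
    simp only [← hval]
    have hc2 : ContinuousOn (fun z : ℂ => (φ z.re : ℂ)) (spectrum ℂ (τ a)) :=
      (Complex.continuous_ofReal.comp (hφcont.comp Complex.continuous_re)).continuousOn
    rw [← hcfc, ← cfc_smul (2 * Real.pi : ℂ) _ (τ a) hc2]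
    exact cfc_congr fun z hz => (hφval z hz).symm
  simp only [hval] at hintE
  rw [SeparatingDual.eq_iff_forall_dual_eq (R := ℂ)]
  intro f
  -- The weak integral in `A` is tested on the functionals `f ∘ τ`, which reduces it to the Bochner
  -- integral in `E`.
  let g : A →L[ℂ] ℂ := ⟨(f : E →ₗ[ℂ] ℂ).comp (τ : A →ₗ[ℂ] E), f.continuous.comp hτ⟩
  have hg : ∀ y, g y = f (τ y) := fun y => rfl
  have h1 := (hx g).2
  simp only [hg] at h1
  rw [h1, inv_mul_eq_iff_eq_mul₀ hpi, ← smul_eq_mul (2 * Real.pi : ℂ), ← map_smul, hcfc2,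
    ← ContinuousLinearMap.integral_comp_comm f hintE]
  simp only [map_smul, smul_eq_mul]

end FunctionalCalculus

/-! ### Weak integrals in Fréchet spaces -/

section WeakIntegrals

open MeasureTheory

/-- The Banach space completion of a vector space for a seminorm. -/
theorem exists_banach_completion {A : Type u} [AddCommGroup A] [Module ℂ A] (q : Seminorm ℂ A) :
    ∃ (E : Type u) (_ : NormedAddCommGroup E) (_ : NormedSpace ℂ E) (_ : CompleteSpace E)
      (ι : A →ₗ[ℂ] E), (∀ a, ‖ι a‖ = q a) ∧ DenseRange ι := by
  let _ : SeminormedAddCommGroup A := q.toAddGroupSeminorm.toSeminormedAddCommGroup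
  have hn : ∀ a : A, ‖a‖ = q a := fun a => rfl
  let _ : NormedSpace ℂ A := ⟨fun c a => by rw [hn, hn, map_smul_eq_mul]⟩
  refine ⟨UniformSpace.Completion A, inferInstance, inferInstance, inferInstance,
    (UniformSpace.Completion.toComplL (𝕜 := ℂ) (E := A)).toLinearMap, fun a => ?_, ?_⟩
  · exact (UniformSpace.Completion.norm_coe a).trans (hn a)
  · exact UniformSpace.Completion.denseRange_coe

variable {A : Type u} [AddCommGroup A] [Module ℂ A]

theorem continuous_of_norm_eq_seminorm [TopologicalSpace A] [IsTopologicalAddGroup A]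
    {E : Type*} [NormedAddCommGroup E] [NormedSpace ℂ E] {q : Seminorm ℂ A} (hq : Continuous q)
    {ι : A →ₗ[ℂ] E} (hι : ∀ a, ‖ι a‖ = q a) : Continuous ι := by
  refine continuous_of_continuousAt_zero ι.toAddMonoidHom ?_
  rw [ContinuousAt, map_zero, tendsto_zero_iff_norm_tendsto_zero]
  have h := hq.tendsto 0
  rw [map_zero] at h
  exact h.congr fun a => (hι a).symm

theorem seminorm_sum_apply (p : ℕ → Seminorm ℂ A) (s : Finset ℕ) (x : A) :
    (∑ k ∈ s, p k) x = ∑ k ∈ s, p k x := by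
  induction s using Finset.cons_induction with
  | empty => simp
  | cons k s hk ih => rw [Finset.sum_cons, Finset.sum_cons, add_apply, ih]

theorem exists_finset_sup_le {p : ℕ → Seminorm ℂ A} (s : Finset ℕ) :
    ∃ n, s.sup p ≤ (Finset.range (n + 1)).sup p :=
  ⟨s.sup id, Finset.sup_mono fun _ hk =>
    Finset.mem_range.2 (Nat.lt_succ_of_le (Finset.le_sup (f := id) hk))⟩

/-- A continuous function into a Fréchet space whose seminorms are dominated by integrable
functions has a weak integral. -/
theorem exists_weak_integral [UniformSpace A] [IsUniformAddGroup A] [CompleteSpace A]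
    {p : ℕ → Seminorm ℂ A} (hp : WithSeminorms p) {F : ℝ → A} (hF : Continuous F)
    (hb : ∀ k, ∃ g : ℝ → ℝ, Integrable g ∧ ∀ t, p k (F t) ≤ g t) :
    ∃ x : A, ∀ f : A →L[ℂ] ℂ, Integrable (fun t => f (F t)) ∧ f x = ∫ t, f (F t) := by
  let q : ℕ → Seminorm ℂ A := fun n => (Finset.range (n + 1)).sup p
  have hpq : ∀ {k n}, k ≤ n → p k ≤ q n := fun h =>
    Finset.le_sup (f := p) (Finset.mem_range.2 (Nat.lt_succ_of_le h))
  have hqq : ∀ {k n}, k ≤ n → q k ≤ q n := fun h =>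
    Finset.sup_mono (Finset.range_mono (Nat.succ_le_succ h))
  have hqc : ∀ n, Continuous (q n) := fun n => by
    have := hp.topologicalAddGroup
    have := hp.continuousSMul
    exact Seminorm.continuous_of_le (q := ∑ k ∈ Finset.range (n + 1), p k) (by
      rw [funext (seminorm_sum_apply p _)]
      exact continuous_finsetSum _ fun k _ => hp.continuous_seminorm k)
      (Seminorm.finset_sup_le_sum p _)
  -- In the Banach completions for the increasing seminorms `q n` the Bochner integrals exist; they
  -- have to be assembled into one element of `A`.
  choose E hE1 hE2 hE3 ι hι hιd using fun n => exists_banach_completion (q n)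
  have hιc : ∀ n, Continuous (ι n) := fun n => continuous_of_norm_eq_seminorm (hqc n) (hι n)
  have hFι : ∀ n, Continuous fun t => ι n (F t) := fun n => (hιc n).comp hF
  have hint : ∀ n, Integrable fun t => ι n (F t) := by
    intro n
    choose g hg hgF using hb
    refine Integrable.mono' (g := fun t => ∑ k ∈ Finset.range (n + 1), g k t)
      (integrable_finsetSum _ fun k _ => hg k) (hFι n).aestronglyMeasurable
      (Filter.Eventually.of_forall fun t => ?_)
    rw [hι]
    refine (Seminorm.finset_sup_le_sum p _ (F t)).trans ?_
    rw [seminorm_sum_apply]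
    exact Finset.sum_le_sum fun k _ => hgF k t
  have happrox : ∀ n, ∃ a : A, ‖ι n a - ∫ t, ι n (F t)‖ < 1 / ((n : ℝ) + 1) := by
    intro n
    obtain ⟨a, ha⟩ := (hιd n).exists_dist_lt (∫ t, ι n (F t))
      (Nat.one_div_pos_of_nat (α := ℝ) (n := n))
    refine ⟨a, ?_⟩
    rwa [dist_comm, dist_eq_norm] at ha
  choose a ha using happrox
  -- For `n ≤ m` the contractive connecting map from `E m` to `E n` carries integral to integral, so
  -- `a m` is equally good an approximation in `E n`.
  have hle : ∀ {n m : ℕ}, n ≤ m → ‖ι n (a m) - ∫ t, ι n (F t)‖ ≤ 1 / ((m : ℝ) + 1) := by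
    intro n m hnm
    have hbd : ∀ x, ‖ι n x‖ ≤ 1 * ‖ι m x‖ := fun x => by
      rw [one_mul, hι, hι]; exact hqq hnm x
    have hT := LinearMap.extendOfNorm_eq (f := ι n) (e := ι m) (hιd m) ⟨1, hbd⟩
    have hTn := LinearMap.norm_extendOfNorm_apply_le (f := ι n) (e := ι m) (hιd m) 1 hbd
      (ι m (a m) - ∫ t, ι m (F t))
    rw [map_sub, hT, ← ContinuousLinearMap.integral_comp_comm _ (hint m)] at hTn
    simp only [hT] at hTn
    rw [one_mul] at hTn
    exact hTn.trans (ha m).le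
  have hlim : ∀ n, Filter.Tendsto (fun m => ι n (a m)) Filter.atTop (𝓝 (∫ t, ι n (F t))) := by
    intro n
    rw [tendsto_iff_norm_sub_tendsto_zero]
    refine squeeze_zero' (Filter.Eventually.of_forall fun m => norm_nonneg _)
      (Filter.eventually_atTop.2 ⟨n, fun m hm => hle hm⟩) tendsto_one_div_add_atTop_nhds_zero_nat
  have hcauchy : CauchySeq a := by
    rw [cauchySeq_iff_tendsto, uniformity_eq_comap_nhds_zero, Filter.tendsto_comap_iff,
      hp.tendsto_nhds]
    intro k ε hε
    have h := (cauchySeq_iff_tendsto.1 (hlim k).cauchySeq)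
    rw [uniformity_eq_comap_nhds_zero, Filter.tendsto_comap_iff] at h
    have h' := h.norm.eventually (gt_mem_nhds (by simpa using hε))
    filter_upwards [h'] with m hm
    refine lt_of_le_of_lt (hpq le_rfl _) (lt_of_eq_of_lt (hι k _).symm ?_)
    simpa using hm
  obtain ⟨x, hx⟩ := cauchySeq_tendsto_of_complete hcauchy
  have hxι : ∀ n, ι n x = ∫ t, ι n (F t) := fun n =>
    tendsto_nhds_unique (((hιc n).tendsto x).comp hx) (hlim n)
  refine ⟨x, fun f => ?_⟩
  -- A continuous functional is bounded by a multiple of some `q n`, hence factors through `E n`.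
  obtain ⟨n, C, hC⟩ : ∃ n, ∃ C : ℝ, ∀ y, ‖f y‖ ≤ C * ‖ι n y‖ := by
    obtain ⟨s, C, -, hs⟩ := Seminorm.bound_of_continuous hp
      ((normSeminorm ℂ ℂ).comp (f : A →ₗ[ℂ] ℂ)) (continuous_norm.comp f.continuous)
    obtain ⟨n, hn⟩ := exists_finset_sup_le (p := p) s
    refine ⟨n, C, fun y => ?_⟩
    rw [hι]
    refine (hs y).trans ?_
    exact mul_le_mul_of_nonneg_left (hn y) C.2
  have hT := LinearMap.extendOfNorm_eq (f := (f : A →ₗ[ℂ] ℂ)) (e := ι n) (hιd n) ⟨C, hC⟩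
  set T := (f : A →ₗ[ℂ] ℂ).extendOfNorm (ι n)
  have hTf : ∀ y, f y = T (ι n y) := fun y => (hT y).symm
  simp only [hTf]
  exact ⟨T.integrable_comp (hint n), by
    rw [hxι, ContinuousLinearMap.integral_comp_comm T (hint n)]⟩

end WeakIntegrals

/-! ### Existence of `φ{a}` -/

section Existence

open MeasureTheory

variable {A : Type u} [NonUnitalRing A] [Module ℂ A] [IsScalarTower ℂ A A] [SMulCommClass ℂ A A]

theorem expTerm_smul (c : ℂ) (a : A) (k : ℕ) :
    expTerm (c • a) k = c ^ (k + 1) • expTerm a k := by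
  have hpow : powSucc (c • a) k = c ^ (k + 1) • powSucc a k := by
    induction k with
    | zero => simp [powSucc]
    | succ k ih => rw [powSucc, ih, smul_mul_smul_comm, ← pow_succ, powSucc]
  rw [expTerm, expTerm, hpow, smul_comm]

variable [UniformSpace A] [IsUniformAddGroup A]

/-- If the series `e(ita)` converge for all `t`, then `t ↦ e(ita)` is continuous. -/
theorem continuous_expSubOne [T2Space A] {p : ℕ → Seminorm ℂ A} (hp : WithSeminorms p) {a : A}
    (ha : ∀ t : ℝ, Summable (expTerm ((Complex.I * t) • a))) :
    Continuous fun t : ℝ => expSubOne ((Complex.I * t) • a) := by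
  rw [continuous_iff_continuousAt]
  intro t₀
  rw [ContinuousAt, hp.tendsto_nhds]
  intro k ε hε
  obtain ⟨E, _, _, _, ι, hι, -⟩ := exists_banach_completion (p k)
  have hιc : Continuous ι := continuous_of_norm_eq_seminorm (hp.continuous_seminorm k) hι
  have hsum : ∀ t : ℝ, HasSum (fun n => ι (expTerm ((Complex.I * t) • a) n))
      (ι (expSubOne ((Complex.I * t) • a))) := fun t => (ha t).hasSum.map ι hιc
  have hnorm : ∀ (t : ℝ) n, ‖ι (expTerm ((Complex.I * t) • a) n)‖ =
      |t| ^ (n + 1) * ‖ι (expTerm a n)‖ := by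
    intro t n
    rw [expTerm_smul, map_smul, norm_smul, norm_pow, norm_mul, Complex.norm_I, one_mul,
      Complex.norm_real, Real.norm_eq_abs]
  set r : ℝ := |t₀| + 1
  have hr : 0 < r := by positivity
  -- Convergence at `2 * r` bounds the terms there by `K`, so at `r` they are at most `K / 2 ^ (n +
  -- 1)`.
  have hu : Summable fun n => r ^ (n + 1) * ‖ι (expTerm a n)‖ := by
    obtain ⟨K, hK⟩ := (hsum (2 * r)).summable.tendsto_atTop_zero.norm.bddAbove_range
    refine Summable.of_nonneg_of_le (fun n => by positivity) (fun n => ?_)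
      ((summable_geometric_two.mul_left (K / 2)))
    have h := hK ⟨n, rfl⟩
    simp only [hnorm] at h
    rw [abs_of_pos (by positivity), mul_pow] at h
    have h2 : (0 : ℝ) < 2 ^ (n + 1) := by positivity
    rw [one_div, inv_pow, div_mul_eq_mul_div, le_div_iff₀ two_pos, ← div_eq_mul_inv,
      le_div_iff₀ (by positivity)]
    refine le_trans (le_of_eq ?_) h
    ring
  have hcont : ContinuousOn (fun t : ℝ => ∑' n, ι (expTerm ((Complex.I * t) • a) n))
      (Set.Icc (-r) r) := by
    refine continuousOn_tsum (fun n => ?_) hu fun n t ht => ?_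
    · simp only [expTerm_smul, map_smul]
      fun_prop
    · rw [hnorm]
      have : |t| ≤ r := abs_le.2 ht
      gcongr
  have hmem : Set.Icc (-r) r ∈ 𝓝 t₀ := by
    apply Icc_mem_nhds <;> simp only [r]
    · linarith [neg_abs_le t₀]
    · linarith [le_abs_self t₀]
  have hc := hcont.continuousAt hmem
  simp only [fun t : ℝ => (hsum t).tsum_eq] at hc
  have h := (tendsto_iff_norm_sub_tendsto_zero.1 hc).eventually (gt_mem_nhds hε)
  filter_upwards [h] with t ht
  rwa [← hι, map_sub]

theorem exists_isFunCalc [CompleteSpace A] [T2Space A] {p : ℕ → Seminorm ℂ A}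
    (hp : WithSeminorms p) {φ : ℝ → ℝ} (hφ : IsTestFun φ) {a : A} (ha : IsPolyBddElem p a) :
    ∃ x, IsFunCalc φ a x := by
  obtain ⟨hd, hc, -⟩ := hφ
  obtain ⟨hsum, hpoly⟩ := ha
  have := hp.continuousSMul
  obtain ⟨x, hx⟩ := exists_weak_integral hp
    (F := fun t => (2 * Real.pi : ℂ)⁻¹ • fourierHat φ t • expSubOne ((Complex.I * t) • a))
    (((continuous_fourierHat hd hc).smul (continuous_expSubOne hp hsum)).const_smul _) (by
      intro k
      obtain ⟨c, hc0, hck⟩ := hpoly k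
      -- With decay of order `c + 2` against growth of order `c`, an integrable `(1 + |t|)⁻²`
      -- remains.
      obtain ⟨n, hn⟩ := exists_nat_ge (c + 2)
      obtain ⟨K, hK0, hK⟩ := exists_fourierHat_decay hd hc n
      refine ⟨fun t => ‖(2 * Real.pi : ℂ)⁻¹‖ * (K * c * (1 + ‖t‖) ^ (-(2 : ℝ))),
        ((integrable_one_add_norm (by simp)).const_mul _).const_mul _, fun t => ?_⟩
      rw [map_smul_eq_mul, map_smul_eq_mul]
      refine mul_le_mul_of_nonneg_left ?_ (norm_nonneg _)
      have h1 : (1 : ℝ) ≤ 1 + |t| := by linarith [abs_nonneg t]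
      have h0 : (0 : ℝ) < 1 + |t| := by linarith
      have h2 : (1 + |t|) ^ c ≤ (1 + |t|) ^ n * (1 + |t|) ^ (-(2 : ℝ)) := by
        rw [← Real.rpow_natCast, ← Real.rpow_add h0]
        exact Real.rpow_le_rpow_of_exponent_le h1 (by linarith)
      rw [Real.norm_eq_abs]
      calc ‖fourierHat φ t‖ * p k (expSubOne ((Complex.I * t) • a))
          ≤ ‖fourierHat φ t‖ * (c * ((1 + |t|) ^ n * (1 + |t|) ^ (-(2 : ℝ)))) := by
            refine mul_le_mul_of_nonneg_left ((hck t).trans ?_) (norm_nonneg _)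
            exact mul_le_mul_of_nonneg_left h2 hc0.le
        _ = ((1 + |t|) ^ n * ‖fourierHat φ t‖) * (c * (1 + |t|) ^ (-(2 : ℝ))) := by ring
        _ ≤ K * (c * (1 + |t|) ^ (-(2 : ℝ))) := by
            refine mul_le_mul_of_nonneg_right (hK t) ?_
            positivity
        _ = K * c * (1 + |t|) ^ (-(2 : ℝ)) := by ring)
  have hpi : (2 * Real.pi : ℂ) ≠ 0 := by
    exact_mod_cast (mul_pos two_pos Real.pi_pos).ne'
  refine ⟨x, fun f => ?_⟩
  obtain ⟨h1, h2⟩ := hx f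
  simp only [map_smul, smul_eq_mul] at h1 h2
  refine ⟨?_, by rw [h2, integral_const_mul]⟩
  have := h1.const_mul (2 * Real.pi : ℂ)
  simpa only [mul_inv_cancel_left₀ hpi] using this

end Existence

/-! ### Functional calculus near zero and near a positive element of norm one -/

section SpectralPerturbation

variable {E : Type*} [CStarAlgebra E]

theorem cfc_eq_zero_of_norm_le {h : E} {r : ℝ} (hr : ‖h‖ ≤ r) {ψ : ℝ → ℝ}
    (hψ : ∀ s ∈ Set.Icc (-r) r, ψ s = 0) : cfc ψ h = 0 := by
  nontriviality E
  rw [← cfc_const_zero ℝ h]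
  refine cfc_congr fun s hs => hψ s (abs_le.1 ?_)
  have := spectrum.norm_le_norm_of_mem hs
  rw [Real.norm_eq_abs] at this
  exact this.trans hr

/-- One of `±‖h‖` is a spectral value. The negative one is excluded: `h ≥ -‖h - y* y‖ > -δ`, whereas
`‖h‖ > 1 - δ ≥ δ`. So `φ(‖h‖) = 1` is in the spectrum of `cfc φ h`. -/
theorem cfc_ne_zero_of_norm_sub_lt {h y : E} (hh : IsSelfAdjoint h) (hy : ‖star y * y‖ = 1)
    {δ : ℝ} (hδ : δ ≤ 1 / 2) (hhy : ‖h - star y * y‖ < δ) {φ : ℝ → ℝ} (hφc : Continuous φ)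
    (hφ : ∀ s ∈ Set.Icc (1 - δ) (1 + δ), φ s = 1) : cfc φ h ≠ 0 := by
  have hnt : Nontrivial E := ⟨star y * y, 0, fun h0 => by rw [h0, norm_zero] at hy; norm_num at hy⟩
  let _ := CStarAlgebra.spectralOrder E
  let _ := CStarAlgebra.spectralOrderedRing E
  have h1 : |‖h‖ - 1| < δ := by
    rw [← hy]; exact (abs_norm_sub_norm_le _ _).trans_lt hhy
  rw [abs_lt] at h1
  have hmem : ‖h‖ ∈ spectrum ℝ h := by
    rcases CStarAlgebra.norm_or_neg_norm_mem_spectrum hh with h2 | h2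
    · exact h2
    exfalso
    have hd : IsSelfAdjoint (h - star y * y) := hh.sub (IsSelfAdjoint.star_mul_self y)
    have h3 := hd.neg_algebraMap_norm_le_self
    have h4 : algebraMap ℝ E (-‖h - star y * y‖) ≤ h := by
      rw [map_neg]
      refine h3.trans ?_
      rw [sub_le_self_iff]
      exact star_mul_self_nonneg y
    rw [algebraMap_le_iff_le_spectrum] at h4
    have := h4 _ h2
    linarith
  intro h0
  have h5 : φ ‖h‖ ∈ spectrum ℝ (cfc φ h) := by
    rw [cfc_map_spectrum φ h hh hφc.continuousOn]
    exact ⟨_, hmem, rfl⟩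
  rw [h0, spectrum.zero_eq, hφ _ ⟨by linarith, by linarith⟩] at h5
  exact one_ne_zero h5

end SpectralPerturbation

/-! ### Properties and existence of constructed pairs -/

section ConstructedPairs

/-- Test functions with the properties required in the construction, for `m = 4`. -/
theorem exists_testFuns : ∃ φ ψ : ℝ → ℝ, IsTestFun φ ∧ IsTestFun ψ ∧
    (∀ᶠ s in 𝓝ˢ (Set.Icc (-(2 / ((4 : ℕ) : ℝ))) (2 / ((4 : ℕ) : ℝ))), ψ s = 0) ∧
    (∀ s ∈ Set.Icc (1 - 1 / ((4 : ℕ) : ℝ)) (1 + 1 / ((4 : ℕ) : ℝ)), φ s = 1) ∧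
    (∀ s, ψ s * φ s = φ s) := by
  -- The conditions force `2/m < 1 - 1/m`, so `m = 4` is the least possible value. Here `φ = 1`
  -- within `1/4` of `1` and vanishes beyond `3/10`; `ψ = 1` up to that distance and vanishes beyond
  -- `4/10`, so below `6/10 > 2/m`.
  let f : ContDiffBump (1 : ℝ) := ⟨1 / 4, 3 / 10, by norm_num, by norm_num⟩
  let g : ContDiffBump (1 : ℝ) := ⟨3 / 10, 4 / 10, by norm_num, by norm_num⟩
  have hg0 : ∀ s : ℝ, s < 6 / 10 → g s = 0 := fun s hs => g.zero_of_le_dist (by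
    rw [Real.dist_eq]
    change 4 / 10 ≤ |s - 1|
    rw [abs_of_neg (by linarith)]
    linarith)
  refine ⟨f, g, ⟨f.contDiff, f.hasCompactSupport, f.zero_of_le_dist ?_⟩,
    ⟨g.contDiff, g.hasCompactSupport, hg0 0 (by norm_num)⟩, ?_, fun s hs => ?_, fun s => ?_⟩
  · rw [Real.dist_eq]
    change 3 / 10 ≤ |(0 : ℝ) - 1|
    norm_num
  · refine Filter.eventually_of_mem ((isOpen_Iio (a := (6 / 10 : ℝ))).mem_nhdsSet.2 ?_) hg0
    intro s hs
    have := hs.2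
    norm_num at this
    exact lt_of_le_of_lt this (by norm_num)
  · refine f.one_of_mem_closedBall ?_
    obtain ⟨h1, h2⟩ := hs
    norm_num at h1 h2
    rw [Metric.mem_closedBall, Real.dist_eq]
    change |s - 1| ≤ 1 / 4
    rw [abs_le]
    constructor <;> linarith
  · by_cases hs : s ∈ Metric.closedBall (1 : ℝ) (3 / 10)
    · rw [g.one_of_mem_closedBall hs, one_mul]
    · rw [f.zero_of_le_dist, mul_zero]
      rw [Metric.mem_closedBall, not_le] at hs
      exact hs.le

variable {A : Type u} [NonUnitalRing A] [Module ℂ A] [IsScalarTower ℂ A A] [SMulCommClass ℂ A A]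
  [UniformSpace A] [IsUniformAddGroup A] [T2Space A] [StarRing A]
  {B : Type v} [NonUnitalCStarAlgebra B] {σ : A →⋆ₙₐ[ℂ] B}

-- Domination by `‖σ x‖` gives automatic continuity, as `map_eq_cfc` requires.
omit [IsScalarTower ℂ A A] [SMulCommClass ℂ A A] [T2Space A] in
theorem IsQuasiSymmetricHom.continuous_of_cstar (hσ : IsQuasiSymmetricHom σ) {E : Type*}
    [CStarAlgebra E] (τ : A →⋆ₙₐ[ℂ] E) : Continuous τ := by
  refine continuous_of_continuousAt_zero τ ?_
  rw [ContinuousAt, map_zero, tendsto_zero_iff_norm_tendsto_zero]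
  have h : Filter.Tendsto (fun x => ‖σ x‖) (𝓝 0) (𝓝 0) := by
    simpa using (hσ.1.tendsto 0).norm
  exact squeeze_zero (fun x => norm_nonneg _)
    (fun x => norm_apply_le_of_quasispectrum_subset hσ.2 τ x) h

variable [StarModule ℂ A]

-- An element killed by `σ` is killed by every *-representation, hence lies in every primitive
-- ideal.
omit [IsUniformAddGroup A] [T2Space A] in
theorem IsQuasiSymmetricHom.injective (hσ : IsQuasiSymmetricHom σ) (hA : IsSemisimple A) {x : A}
    (hx : σ x = 0) : x = 0 := by
  have : x ∈ kernel (Prim A) := by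
    rw [kernel, Submodule.mem_sInf]
    intro J hJ
    obtain ⟨H, _, _, _, π, -, hπ⟩ := exists_isTopIrreducible_of_mem_prim hσ.2 hJ
    rw [hπ, ← norm_le_zero_iff]
    exact (norm_apply_le_of_quasispectrum_subset hσ.2 π x).trans (by rw [hx, norm_zero])
  rw [hA] at this
  exact (Submodule.mem_bot ℂ).1 this

theorem isRegularPair_of_isConstructedPair (hσ : IsQuasiSymmetricHom σ) (hA : IsSemisimple A)
    {p : ℕ → Seminorm ℂ A} {C : Set (Submodule ℂ A)} (hC : C ⊆ Prim A) {J : Submodule ℂ A}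
    {a b : A} (hab : IsConstructedPair p σ C J a b) : IsRegularPair C J a b := by
  obtain ⟨u, q, m, a₀, φ, ψ, hu, ⟨H, _, _, _, π, -, hπ, hnorm⟩, -, hq, hm, hsa, ⟨hsum, -⟩, hqa, hφ,
    hψ, hψ0, hφ1, hψφ, ha, hb⟩ := hab
  have hm0 : (0 : ℝ) < m := by exact_mod_cast (by omega : 0 < m)
  have hm2 : 1 / (m : ℝ) ≤ 1 / 2 := one_div_le_one_div_of_le two_pos (by exact_mod_cast hm)
  refine ⟨?_, ?_, ?_⟩
  · rw [kernel, Submodule.mem_sInf] at hu ⊢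
    intro I hI
    obtain ⟨K, _, _, _, ρ, -, hρ⟩ := exists_isTopIrreducible_of_mem_prim hσ.2 (hC hI)
    rw [hρ, hb.map_eq_cfc hψ hsa hsum (hσ.continuous_of_cstar ρ)]
    -- Since `ρ u = 0`, the image of `a₀` is that of the small difference `a₀ - u* u`.
    have h1 : ρ (a₀ - star u * u) = ρ a₀ := by
      rw [map_sub, map_mul, (hρ u).1 (hu I hI), mul_zero, sub_zero]
    refine cfc_eq_zero_of_norm_le (r := 2 / m) ?_ fun s hs => hψ0.self_of_nhdsSet s hs
    rw [← h1]
    refine (norm_apply_le_of_quasispectrum_subset hσ.2 ρ _).trans ((hq _).trans (hqa.le.trans ?_))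
    gcongr
    norm_num
  · rw [hπ, ha.map_eq_cfc hφ hsa hsum (hσ.continuous_of_cstar π)]
    rw [map_mul, map_star] at hnorm
    refine cfc_ne_zero_of_norm_sub_lt (hsa.map π) hnorm hm2 ?_ hφ.1.continuous hφ1
    rw [← map_star, ← map_mul, ← map_sub]
    exact (norm_apply_le_of_quasispectrum_subset hσ.2 π _).trans_lt ((hq _).trans_lt hqa)
  · rw [← sub_eq_zero]
    apply hσ.injective hA
    -- The comparison of functional calculi needs a unital target.
    let τ : A →⋆ₙₐ[ℂ] Unitization ℂ B := (Unitization.inrNonUnitalStarAlgHom ℂ B).comp σ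
    have hτ : Continuous τ := hσ.continuous_of_cstar τ
    have h1 : τ (b * a) = τ a := by
      rw [map_mul, hb.map_eq_cfc hψ hsa hsum hτ, ha.map_eq_cfc hφ hsa hsum hτ,
        ← cfc_mul ψ φ (τ a₀) hψ.1.continuous.continuousOn hφ.1.continuous.continuousOn]
      exact congrArg (fun f => cfc f (τ a₀)) (funext hψφ)
    have h2 : σ (b * a) = σ a := Unitization.inr_injective (R := ℂ) h1
    rw [map_sub, h2, sub_self]

theorem exists_isConstructedPair [CompleteSpace A] {p : ℕ → Seminorm ℂ A}
    (hp : WithSeminorms p) (hσ : IsQuasiSymmetricHom σ) (hpb : IsPolyBddAlgebra p)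
    {C : Set (Submodule ℂ A)} (hC : IsHullKernelClosed C) {J : Submodule ℂ A}
    (hJ : J ∈ Prim A \ C) : ∃ a b : A, IsConstructedPair p σ C J a b := by
  obtain ⟨H, _, _, _, π, hirr, hπ⟩ := exists_isTopIrreducible_of_mem_prim hσ.2 hJ.1
  have hle : ¬ kernel C ≤ J := fun h => hJ.2 (hC ▸ ⟨hJ.1, h⟩)
  obtain ⟨u₀, hu₀, hu₀J⟩ := SetLike.not_le_iff_exists.1 hle
  have hn : ‖π u₀‖ ≠ 0 := fun h => hu₀J ((hπ _).2 (norm_eq_zero.1 h))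
  -- This scaling gives `‖π u‖ = 1`, hence `‖π (u* u)‖ = 1`.
  set u : A := ((‖π u₀‖⁻¹ : ℝ) : ℂ) • u₀ with hu
  have hunorm : ‖π (star u * u)‖ = 1 := by
    rw [map_mul, map_star, CStarRing.norm_star_mul_self, hu, map_smul, norm_smul,
      Complex.norm_real, norm_inv, norm_norm, inv_mul_cancel₀ hn, one_mul]
  let q : Seminorm ℂ A := (normSeminorm ℂ B).comp (σ : A →ₗ[ℂ] B)
  have hq : ∀ x, q x = ‖σ x‖ := fun x => rfl
  have hqc : Continuous q := hσ.1.norm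
  have hnhds : {x | q (x - star u * u) < 1 / ((4 : ℕ) : ℝ)} ∈ 𝓝 (star u * u) := by
    have : Continuous fun x => q (x - star u * u) := hqc.comp (continuous_id.sub continuous_const)
    refine (isOpen_lt this continuous_const).mem_nhds ?_
    simp
  obtain ⟨a₀, hqa, hsa, hpoly⟩ :=
    mem_closure_iff_nhds.1 (hpb _ (IsSelfAdjoint.star_mul_self u)) _ hnhds
  obtain ⟨φ, ψ, hφ, hψ, hψ0, hφ1, hψφ⟩ := exists_testFuns
  obtain ⟨a, ha⟩ := exists_isFunCalc hp hφ hpoly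
  obtain ⟨b, hb⟩ := exists_isFunCalc hp hψ hpoly
  exact ⟨a, b, u, q, 4, a₀, φ, ψ, Submodule.smul_mem _ _ hu₀,
    ⟨H, inferInstance, inferInstance, inferInstance, π, hirr, hπ, hunorm⟩, hqc,
    fun x => (hq x).ge, by norm_num, hsa, hpoly, hqa, hφ, hψ, hψ0, hφ1, hψφ, ha, hb⟩

end ConstructedPairs

end QuasiSymmetric

theorem corollary3p11
    -- an involutive complex Frechet algebra, with its defining sequence of seminorms
    {A : Type u} [NonUnitalRing A] [Module ℂ A] [IsScalarTower ℂ A A] [SMulCommClass ℂ A A]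
    [UniformSpace A] [IsUniformAddGroup A] [CompleteSpace A] [T2Space A] [ContinuousMul A]
    [StarRing A] [StarModule ℂ A] [ContinuousStar A]
    (p : ℕ → Seminorm ℂ A) (hp : WithSeminorms p)
    -- semisimple, quasi-symmetric (through `σ`), polynomially bounded
    (hss : QuasiSymmetric.IsSemisimple A)
    {B : Type v} [NonUnitalCStarAlgebra B] (σ : A →⋆ₙₐ[ℂ] B)
    (hqs : QuasiSymmetric.IsQuasiSymmetricHom σ)
    (hpb : QuasiSymmetric.IsPolyBddAlgebra p)
    -- a closed set of primitive ideals
    (C : Set (Submodule ℂ A)) (hC : QuasiSymmetric.IsHullKernelClosed C) :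
    -- the construction of the elements `a_J`, `b_J` can be carried out for every `J ∉ C`, and
    -- always gives elements as in the definition of hull-kernel regularity
    (∀ J ∈ QuasiSymmetric.Prim A \ C,
      (∃ a b : A, QuasiSymmetric.IsConstructedPair p σ C J a b) ∧
      ∀ a b : A, QuasiSymmetric.IsConstructedPair p σ C J a b →
        QuasiSymmetric.IsRegularPair C J a b) ∧
    -- the hull-minimal ideal `j(C)` exists, and is generated by the elements `a_J`
    ∃ j : Submodule ℂ A, QuasiSymmetric.IsHullMinimalIdeal C j ∧
      ∀ a b : ↥(QuasiSymmetric.Prim A \ C) → A,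
        (∀ J, QuasiSymmetric.IsRegularPair C J.1 (a J) (b J)) →
        j = QuasiSymmetric.idealSpan (Set.range a) := by
  have hreg : ∀ J ∈ QuasiSymmetric.Prim A \ C, ∀ a b : A,
      QuasiSymmetric.IsConstructedPair p σ C J a b → QuasiSymmetric.IsRegularPair C J a b :=
    fun J _ a b => QuasiSymmetric.isRegularPair_of_isConstructedPair hqs hss
      (QuasiSymmetric.subset_prim_of_isHullKernelClosed hC)
  have hex : ∀ J ∈ QuasiSymmetric.Prim A \ C,
      ∃ a b : A, QuasiSymmetric.IsConstructedPair p σ C J a b :=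
    fun J hJ => QuasiSymmetric.exists_isConstructedPair hp hqs hpb hC hJ
  refine ⟨fun J hJ => ⟨hex J hJ, hreg J hJ⟩, ?_⟩
  choose a b hab using fun J : ↥(QuasiSymmetric.Prim A \ C) => hex J.1 J.2
  have hj := QuasiSymmetric.isHullMinimalIdeal_idealSpan hC
    fun J => hreg J.1 J.2 (a J) (b J) (hab J)
  -- Any other choice also generates a least ideal with hull `C`, and least elements are unique.
  exact ⟨_, hj, fun a' b' h => hj.unique (QuasiSymmetric.isHullMinimalIdeal_idealSpan hC h)⟩
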